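/- Let $\mathrm{GF}(q)$ be a finite field with $q\neq 2$, and let $D,N$ be integers with $N>2D\ge 6$. Let $\Gamma$ be the bilinear forms graph: its vertex set $X$ consists of the $D\times(N-D)$ matrices over $\mathrm{GF}(q)$, and two vertices are adjacent whenever their difference has rank one. Let $\partial$ be the path-length distance and put $\Gamma_i(x)=\{z\in X:\partial(x,z)=i\}$, $\Gamma(x)=\Gamma_1(x)$. Let $V=\mathbb R^X$ with standard basis $\{\hat x : x\in X\}$, and $\widehat\Omega=\sum_{z\in\Omega}\hat z$ for $\Omega\subseteq X$. Let $A$ be the adjacency matrix of $\Gamma$, let $\theta_0>\theta_1>\cdots$ be its distinct eigenvalues, and let $E$ be the primitive idempotent associated with $\theta_1$, that is, the real matrix that acts as the identity on the $\theta_1$-eigenspace of $A$ and as $0$ on every other eigenspace. On $EV$ define the Norton product $u\star v=E(u\circ v)$, where $\circ$ is the entrywise product. Fix $x,y\in X$ and write $k=\partial(x,y)$; assume $2\le k\le D-1$. For $z\in X$ put $\alpha(z)=|\Gamma(x)\cap\Gamma(z)\cap\Gamma_{k-1}(y)|$ and $\beta(z)=|\Gamma(x)\cap\Gamma(z)\cap\Gamma_{k+1}(y)|$.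 Let $O_1=\Gamma(x)\cap\Gamma_{k-1}(y)$ and $O_6=\Gamma(x)\cap\Gamma_{k+1}(y)$, and let $O_2,O_3,O_4,O_5$ be the sets of those $z\in\Gamma(x)\cap\Gamma_k(y)$ for which $(\alpha(z),\beta(z))$ equals, respectively, $$(2q^{k-1},\,0),\qquad (2q^{k-1}-1,\,0),\qquad (q^{k-1},\,q^D-q^k),\qquad (q^{k-1},\,q^{N-D}-q^k).$$ Let $S$ be the subspace of $EV$ spanned by $E\widehat O_1,\dots,E\widehat O_6$. Then $$E\hat x\star S\subseteq S,\qquad E\hat y\star S\subseteq S .$$ Moreover, $\{O_i\}_{i=1}^6$ is an equitable partition of $\Gamma(x)$ into nonempty sets: there is a $6\times 6$ matrix $C$ such that for all $i,j$ every vertex of $O_i$ is adjacent to exactly $C_{i,j}$ vertices of $O_j$. With this matrix, $$E\hat x\star E\widehat O_j=|X|^{-1}\sum_{i=1}^6 C_{i,j}\,E\widehat O_i\qquad(1\le j\le 6).$$ -/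

import Mathlib

open scoped Matrix

noncomputable section

/-- The bilinear forms graph on the `d × e` matrices over `F`: two matrices are adjacent when
their difference has rank one. -/
def bilinearFormsGraph (F : Type*) [Field F] (d e : ℕ) :
    SimpleGraph (Matrix (Fin d) (Fin e) F) where
  Adj x y := (x - y).rank = 1
  symm := ⟨fun x y h => by
    have hr : (y - x).rank = ((-1 : F) • (x - y)).rank := by simp
    rw [hr, Matrix.rank_smul_of_mem_nonZeroDivisors _ (by simp)]
    exact h⟩
  loopless := ⟨fun x h => by simp at h⟩

section Graph

variable {X : Type*} [Fintype X] [DecidableEq X]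

/-- `Γ_i(x)`, the set of vertices at path-length distance `i` from `x`. -/
def distSphere (G : SimpleGraph X) (i : ℕ) (x : X) : Finset X :=
  Finset.univ.filter fun y => G.dist x y = i

open Classical in
/-- The real adjacency matrix of `G`. -/
def realAdjMatrix (G : SimpleGraph X) : Matrix X X ℝ := G.adjMatrix ℝ

/-- The eigenvalues of `G`: the roots of the minimal polynomial of the adjacency matrix. -/
def graphEigenvalues (G : SimpleGraph X) : Finset ℝ :=
  (minpoly ℝ (realAdjMatrix G)).roots.toFinset

/-- `θ_i`, where `θ_0 > θ_1 > ⋯` are the distinct eigenvalues of `G` (and `0` if there are at most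
`i` of them). -/
def orderedEigenvalue (G : SimpleGraph X) (i : ℕ) : ℝ :=
  ((graphEigenvalues G).sort (· ≥ ·)).getD i 0

/-- The matrix of the orthogonal projection of `ℝ^X` onto the `θ`-eigenspace of `A`. For a symmetric
`A` it is the matrix that acts as the identity on the `θ`-eigenspace and as zero on every other
eigenspace, see `primitiveIdempotent_mulVec_self` and `primitiveIdempotent_mulVec_of_ne`. -/
def primitiveIdempotent (A : Matrix X X ℝ) (θ : ℝ) : Matrix X X ℝ :=
  Matrix.toEuclideanLin.symm
    ((Module.End.eigenspace (Matrix.toEuclideanLin A) θ).starProjection :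
      EuclideanSpace ℝ X →ₗ[ℝ] EuclideanSpace ℝ X)

theorem primitiveIdempotent_mulVec (A : Matrix X X ℝ) (θ : ℝ) (v : X → ℝ) :
    primitiveIdempotent A θ *ᵥ v = WithLp.ofLp
      ((Module.End.eigenspace (Matrix.toEuclideanLin A) θ).starProjection (WithLp.toLp 2 v)) := by
  have h : Matrix.toEuclideanLin (primitiveIdempotent A θ) (WithLp.toLp 2 v) =
      (Module.End.eigenspace (Matrix.toEuclideanLin A) θ).starProjection (WithLp.toLp 2 v) := by
    simp [primitiveIdempotent]
  rw [← h]
  simp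

theorem mem_eigenspace_toEuclideanLin {A : Matrix X X ℝ} {θ : ℝ} {v : X → ℝ}
    (hv : A *ᵥ v = θ • v) :
    WithLp.toLp 2 v ∈ Module.End.eigenspace (Matrix.toEuclideanLin A) θ := by
  rw [Module.End.mem_eigenspace_iff, Matrix.toLpLin_toLp, Matrix.toLin'_apply, hv]
  rfl

theorem primitiveIdempotent_mulVec_self (A : Matrix X X ℝ) (θ : ℝ) (v : X → ℝ)
    (hv : A *ᵥ v = θ • v) : primitiveIdempotent A θ *ᵥ v = v := by
  rw [primitiveIdempotent_mulVec,
    Submodule.starProjection_eq_self_iff.mpr (mem_eigenspace_toEuclideanLin hv)]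

theorem primitiveIdempotent_mulVec_of_ne (A : Matrix X X ℝ) (hA : A.IsSymm) (θ μ : ℝ)
    (hμ : μ ≠ θ) (v : X → ℝ) (hv : A *ᵥ v = μ • v) : primitiveIdempotent A θ *ᵥ v = 0 := by
  have hA' : (Matrix.toEuclideanLin A).IsSymmetric :=
    Matrix.isSymmetric_toEuclideanLin_iff.mpr hA
  have h0 : (Module.End.eigenspace (Matrix.toEuclideanLin A) θ).starProjection
      (WithLp.toLp 2 v) = 0 := by
    rw [Submodule.starProjection_apply_eq_zero_iff, Submodule.mem_orthogonal]
    intro w hw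
    exact hA'.orthogonalFamily_eigenspaces hμ.symm ⟨w, hw⟩
      ⟨_, mem_eigenspace_toEuclideanLin hv⟩
  rw [primitiveIdempotent_mulVec, h0]
  rfl

/-- The characteristic vector `∑_{z ∈ Ω} ẑ` of a set of vertices. -/
def charVec (Ω : Finset X) : X → ℝ := ∑ z ∈ Ω, Pi.single z 1

/-- The space `EV`, where `V = ℝ^X`. -/
abbrev imageSpace (E : Matrix X X ℝ) : Submodule ℝ (X → ℝ) := LinearMap.range E.mulVecLin

/-- The vector `E v`, as an element of `EV`. -/
def toImage (E : Matrix X X ℝ) (v : X → ℝ) : imageSpace E := ⟨E *ᵥ v, v, rfl⟩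

/-- The Norton product `u ⋆ v = E (u ∘ v)` on `EV`, where `∘` is the entrywise product. -/
def nortonMul (E : Matrix X X ℝ) (u v : imageSpace E) : imageSpace E :=
  toImage E ((u : X → ℝ) * (v : X → ℝ))

/-- The sets `O` form an equitable partition, with quotient matrix `C`, of the subgraph of `G`
induced on `T`. -/
structure IsEquitablePartition (G : SimpleGraph X) (T : Finset X) {n : ℕ} (O : Fin n → Finset X)
    (C : Matrix (Fin n) (Fin n) ℕ) : Prop where
  nonempty : ∀ i, (O i).Nonempty
  disjoint : ∀ i j, i ≠ j → Disjoint (O i) (O j)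
  cover : Finset.univ.biUnion O = T
  count : ∀ i j, ∀ z ∈ O i, (distSphere G 1 z ∩ O j).card = C i j

end Graph

section BilinearForms

variable {F : Type*} [Field F] [Fintype F] [DecidableEq F] {d e : ℕ}

/-- The sets `O_1, …, O_6` (indexed here by `0, …, 5`) of the `y`-partition of `Γ(x)`, in the
bilinear forms graph on the `d × e` matrices; here `k` is the distance between `x` and `y`. -/
def yPartition (x y : Matrix (Fin d) (Fin e) F) : Fin 6 → Finset (Matrix (Fin d) (Fin e) F) :=
  let Γ := distSphere (bilinearFormsGraph F d e)
  let q := Fintype.card F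
  let k := (bilinearFormsGraph F d e).dist x y
  ![Γ 1 x ∩ Γ (k - 1) y,
    {z ∈ Γ 1 x ∩ Γ k y | (Γ 1 x ∩ Γ 1 z ∩ Γ (k - 1) y).card = 2 * q ^ (k - 1) ∧
      (Γ 1 x ∩ Γ 1 z ∩ Γ (k + 1) y).card = 0},
    {z ∈ Γ 1 x ∩ Γ k y | (Γ 1 x ∩ Γ 1 z ∩ Γ (k - 1) y).card = 2 * q ^ (k - 1) - 1 ∧
      (Γ 1 x ∩ Γ 1 z ∩ Γ (k + 1) y).card = 0},
    {z ∈ Γ 1 x ∩ Γ k y | (Γ 1 x ∩ Γ 1 z ∩ Γ (k - 1) y).card = q ^ (k - 1) ∧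
      (Γ 1 x ∩ Γ 1 z ∩ Γ (k + 1) y).card = q ^ d - q ^ k},
    {z ∈ Γ 1 x ∩ Γ k y | (Γ 1 x ∩ Γ 1 z ∩ Γ (k - 1) y).card = q ^ (k - 1) ∧
      (Γ 1 x ∩ Γ 1 z ∩ Γ (k + 1) y).card = q ^ e - q ^ k},
    Γ 1 x ∩ Γ (k + 1) y]

/-- The primitive idempotent of the bilinear forms graph associated with its second largest
eigenvalue `θ_1`. -/
def bilinearIdempotent (F : Type*) [Field F] [Fintype F] [DecidableEq F] (d e : ℕ) :
    Matrix (Matrix (Fin d) (Fin e) F) (Matrix (Fin d) (Fin e) F) ℝ :=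
  primitiveIdempotent (realAdjMatrix (bilinearFormsGraph F d e))
    (orderedEigenvalue (bilinearFormsGraph F d e) 1)

/-- The subspace `S(x, y)` of `EV` spanned by the vectors `E Ô_1, …, E Ô_6`. -/
def spaceS (x y : Matrix (Fin d) (Fin e) F) :
    Submodule ℝ (imageSpace (bilinearIdempotent F d e)) :=
  Submodule.span ℝ
    (Set.range fun i => toImage (bilinearIdempotent F d e) (charVec (yPartition x y i)))

end BilinearForms

end

noncomputable section

/-! ### Rank one perturbations, path-length distance, and generalized inverses. -/

section RankOne

variable {F : Type*} [Field F] {d e : ℕ}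

open Matrix Module

/-! The graph is a Cayley graph on the additive group of matrices, so the characters χ_B = `matChar
B` diagonalise `A`. The eigenvalue of χ_B depends only on the rank of `B` and decreases with it, so
`E` projects onto the span of the χ_B with `B` of rank one (`bilinearIdempotent_eq_dualProj`). On
the Fourier side the Norton product is a convolution over rank one matrices. For adjacent `x`, `z`
its coefficient at `B` is, up to the factor |X|⁻¹, χ_B(-x) times the sum of χ_Q(-(z - x)) over the
rank one `Q` adjacent to `B`. That sum is symmetric in `B` and `z - x`
(`sum_matChar_neighbors_comm`), hence it is also the transform of the set of common neighbours, and
E x̂ ⋆ E ẑ is |X|⁻¹ times `E` of that set (`norton_single_single`). Summing over `z` in O_j and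
using equitability gives the product formula and the invariance of `S` under E x̂.

For the partition, put M = y - x and z - x = u vᵀ. The class of `z` records whether `u` lies in the
column space of `M`, whether `v` lies in its row space, and, if both hold, whether the pairing vᵀ G
u is 1, 0 or something else, where `G` is a generalized inverse of `M`. These six classes are the
sets O_i (`yPartition_eq`). The neighbours of u vᵀ share its column or its row space, so their
distribution over the classes depends only on the class of u vᵀ (`card_neighbors_matClass`).

Invariance under E ŷ follows from S(x,y) = S(y,x) (`spaceS_swap`). The transform of Ô_i at a rank
one `C` is χ_C(-x) times `classSum`. For every class except O_1 and O_3 this class sum is a constant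
c wherever χ_C(M) ≠ 1 (`constantOff_classSum`), while χ_C(-x) = χ_C(-y) where χ_C(M) = 1; so
exchanging `x` and `y` adds c (E ŷ - E x̂) to E Ô_i. The class sums of O_1 and O_2 differ by an
affine function of χ_C(-M) (`classSum_zero_sub_classSum_one`), which puts E ŷ in `S` and settles
O_1. Finally O_3 is recovered from ∑ E Ô_i = θ_1 E x̂. -/

theorem matrix_rank_eq_zero {z : Matrix (Fin d) (Fin e) F} : z.rank = 0 ↔ z = 0 := by
  refine ⟨fun h => ?_, fun h => by rw [h, rank_zero]⟩
  rw [Matrix.rank, Submodule.finrank_eq_zero, LinearMap.range_eq_bot] at h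
  apply Matrix.mulVec_injective
  funext x
  rw [zero_mulVec]
  exact LinearMap.congr_fun h x

theorem rank_vecMulVec_eq_one {u : Fin d → F} {v : Fin e → F} (hu : u ≠ 0) (hv : v ≠ 0) :
    (vecMulVec u v).rank = 1 := by
  refine le_antisymm (rank_vecMulVec_le u v) ?_
  rw [Nat.one_le_iff_ne_zero]
  intro h
  rw [matrix_rank_eq_zero] at h
  obtain ⟨i, hi⟩ := Function.ne_iff.1 hu
  obtain ⟨j, hj⟩ := Function.ne_iff.1 hv
  exact mul_ne_zero hi hj (by rw [← vecMulVec_apply u v, h]; rfl)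

theorem exists_vecMulVec_of_rank_eq_one {z : Matrix (Fin d) (Fin e) F} (hz : z.rank = 1) :
    ∃ u v, u ≠ 0 ∧ v ≠ 0 ∧ z = vecMulVec u v := by
  obtain ⟨⟨u, hu⟩, hu0, h⟩ := finrank_eq_one_iff'.1 hz
  have hu0' : u ≠ 0 := fun h => hu0 (Subtype.ext h)
  have key : ∀ j, ∃ c : F, c • u = z *ᵥ Pi.single j 1 := by
    intro j
    obtain ⟨c, hc⟩ := h ⟨z *ᵥ Pi.single j 1, _, rfl⟩
    exact ⟨c, congrArg Subtype.val hc⟩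
  choose v hv using key
  have hzv : z = vecMulVec u v := by
    ext i j
    have := congrFun (hv j) i
    simp at this
    rw [vecMulVec_apply, ← this, mul_comm]
  refine ⟨u, v, hu0', ?_, hzv⟩
  rintro rfl
  have : z = 0 := by rw [hzv]; ext i j; simp [vecMulVec_apply]
  rw [this, rank_zero] at hz
  exact zero_ne_one hz

theorem rank_add_le_add_rank (A B : Matrix (Fin d) (Fin e) F) :
    (A + B).rank ≤ A.rank + B.rank := by
  unfold Matrix.rank
  refine le_trans ?_ (Submodule.finrank_add_le_finrank_add_finrank _ _)
  apply Submodule.finrank_mono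
  rintro _ ⟨x, rfl⟩
  rw [mulVecLin_apply, add_mulVec]
  exact Submodule.add_mem_sup ⟨x, rfl⟩ ⟨x, rfl⟩

theorem rank_neg_matrix (A : Matrix (Fin d) (Fin e) F) : (-A).rank = A.rank := by
  have hr : (-A).rank = ((-1 : F) • A).rank := by simp
  rw [hr, Matrix.rank_smul_of_mem_nonZeroDivisors _ (by simp)]

theorem rank_sub_comm (A B : Matrix (Fin d) (Fin e) F) : (A - B).rank = (B - A).rank := by
  rw [← rank_neg_matrix, neg_sub]

theorem rank_add_finrank_ker (A : Matrix (Fin d) (Fin e) F) :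
    A.rank + finrank F (LinearMap.ker A.mulVecLin) = e := by
  have := LinearMap.finrank_range_add_finrank_ker A.mulVecLin
  rwa [finrank_fin_fun] at this

theorem rank_le_rank_of_ker_le {d' : ℕ} {A : Matrix (Fin d) (Fin e) F}
    {B : Matrix (Fin d') (Fin e) F}
    (h : ∀ x, A *ᵥ x = 0 → B *ᵥ x = 0) : B.rank ≤ A.rank := by
  have h1 := rank_add_finrank_ker A
  have h2 := rank_add_finrank_ker B
  have h3 : finrank F (LinearMap.ker A.mulVecLin) ≤ finrank F (LinearMap.ker B.mulVecLin) :=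
    Submodule.finrank_mono fun x hx => h x hx
  lia

theorem rank_lt_rank_of_ker_lt {A B : Matrix (Fin d) (Fin e) F}
    (h : ∀ x, A *ᵥ x = 0 → B *ᵥ x = 0) (p : Fin e → F) (hB : B *ᵥ p = 0) (hA : A *ᵥ p ≠ 0) :
    B.rank < A.rank := by
  have h1 := rank_add_finrank_ker A
  have h2 := rank_add_finrank_ker B
  have h3 : finrank F (LinearMap.ker A.mulVecLin) < finrank F (LinearMap.ker B.mulVecLin) :=
    Submodule.finrank_lt_finrank_of_lt
      (lt_of_le_of_ne (fun x hx => h x hx) fun heq => hA (by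
        have : p ∈ LinearMap.ker B.mulVecLin := hB
        rw [← heq] at this
        exact this))
  lia

theorem sub_vecMulVec_mulVec (M : Matrix (Fin d) (Fin e) F) (u : Fin d → F) (v x : Fin e → F) :
    (M - vecMulVec u v) *ᵥ x = M *ᵥ x - (v ⬝ᵥ x) • u := by
  rw [sub_mulVec, vecMulVec_mulVec, op_smul_eq_smul]

theorem transpose_sub_vecMulVec (M : Matrix (Fin d) (Fin e) F) (u : Fin d → F) (v : Fin e → F) :
    (M - vecMulVec u v)ᵀ = Mᵀ - vecMulVec v u := by
  rw [transpose_sub, transpose_vecMulVec]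

/-- Subtracting the rank one matrix `M p rᵀ M` with `rᵀ M p = 1` lowers the rank of `M`. -/
theorem rank_sub_vecMulVec_lt (M : Matrix (Fin d) (Fin e) F) (p : Fin e → F) (r : Fin d → F)
    (h : (r ᵥ* M) ⬝ᵥ p = 1) : (M - vecMulVec (M *ᵥ p) (r ᵥ* M)).rank < M.rank := by
  refine rank_lt_rank_of_ker_lt (fun x hx => ?_) p ?_ ?_
  · rw [sub_vecMulVec_mulVec, hx, ← dotProduct_mulVec, hx, dotProduct_zero]
    simp
  · rw [sub_vecMulVec_mulVec, h, one_smul, sub_self]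
  · intro h0
    rw [← dotProduct_mulVec, h0, dotProduct_zero] at h
    exact zero_ne_one h

theorem exists_rank_one_sub_lt {M : Matrix (Fin d) (Fin e) F} (hM : M ≠ 0) :
    ∃ z : Matrix (Fin d) (Fin e) F, z.rank = 1 ∧ (M - z).rank < M.rank := by
  obtain ⟨i, j, hij⟩ : ∃ i j, M i j ≠ 0 := by
    by_contra! h
    exact hM (Matrix.ext h)
  -- The row and column of `M` through a nonzero entry, scaled so that their pairing is 1.
  have h1 : (Pi.single i (1 : F) ᵥ* M) ⬝ᵥ (Pi.single j (M i j)⁻¹) = 1 := by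
    simp [hij]
  refine ⟨_, rank_vecMulVec_eq_one ?_ ?_, rank_sub_vecMulVec_lt M _ _ h1⟩
  · intro h
    rw [← dotProduct_mulVec, h, dotProduct_zero] at h1
    exact zero_ne_one h1
  · intro h
    rw [h, zero_dotProduct] at h1
    exact zero_ne_one h1

theorem bilinearFormsGraph_adj {x y : Matrix (Fin d) (Fin e) F} :
    (bilinearFormsGraph F d e).Adj x y ↔ (x - y).rank = 1 := Iff.rfl

theorem exists_walk_length_le_rank (n : ℕ) : ∀ x y : Matrix (Fin d) (Fin e) F, (x - y).rank ≤ n →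
    ∃ w : (bilinearFormsGraph F d e).Walk x y, w.length ≤ n := by
  induction n with
  | zero =>
    intro x y h
    have : x = y := by rwa [Nat.le_zero, matrix_rank_eq_zero, sub_eq_zero] at h
    subst this
    exact ⟨.nil, le_rfl⟩
  | succ n ih =>
    intro x y h
    by_cases hxy : x - y = 0
    · rw [sub_eq_zero] at hxy
      subst hxy
      exact ⟨.nil, Nat.zero_le _⟩
    · obtain ⟨z, hz, hlt⟩ := exists_rank_one_sub_lt hxy
      obtain ⟨w, hw⟩ := ih (x - z) y (by rw [sub_right_comm]; lia)
      have hadj : (bilinearFormsGraph F d e).Adj x (x - z) := by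
        rw [bilinearFormsGraph_adj, sub_sub_cancel, hz]
      exact ⟨.cons hadj w, by simpa using hw⟩

theorem rank_sub_le_length {x y : Matrix (Fin d) (Fin e) F}
    (w : (bilinearFormsGraph F d e).Walk x y) : (x - y).rank ≤ w.length := by
  induction w with
  | nil => simp
  | cons h p ih =>
    rename_i a b c
    rw [SimpleGraph.Walk.length_cons, ← sub_add_sub_cancel a b c]
    refine (rank_add_le_add_rank _ _).trans ?_
    rw [bilinearFormsGraph_adj] at h
    lia

/-- Subadditivity of the rank bounds the distance from below; peeling off rank one matrices that
lower the rank gives a walk that attains the bound. -/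
theorem bilinearFormsGraph_dist (x y : Matrix (Fin d) (Fin e) F) :
    (bilinearFormsGraph F d e).dist x y = (x - y).rank := by
  obtain ⟨w, hw⟩ := exists_walk_length_le_rank _ x y le_rfl
  refine le_antisymm ((SimpleGraph.dist_le w).trans hw) ?_
  obtain ⟨w', hw'⟩ := w.reachable.exists_walk_length_eq_dist
  rw [← hw']
  exact rank_sub_le_length w'

/-! ### Generalized inverses -/

/-- `G` is a linear section of `M` over its column space, extended to the whole space. Then `M * G`
and `G * M` are projections that test membership in the column and row spaces of `M`. -/
theorem exists_generalized_inverse (M : Matrix (Fin d) (Fin e) F) :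
    ∃ G : Matrix (Fin e) (Fin d) F, M * G * M = M := by
  obtain ⟨g, hg⟩ := M.mulVecLin.rangeRestrict.exists_rightInverse_of_surjective
    (LinearMap.range_rangeRestrict _)
  obtain ⟨g', hg'⟩ := LinearMap.exists_extend g
  refine ⟨LinearMap.toMatrix' g', ?_⟩
  apply Matrix.mulVec_injective
  funext x
  rw [← mulVec_mulVec, ← mulVec_mulVec, LinearMap.toMatrix'_mulVec]
  have h1 : g' (M *ᵥ x) = g (M.mulVecLin.rangeRestrict x) := by
    rw [← hg']; rfl
  rw [h1]
  have := LinearMap.congr_fun hg (M.mulVecLin.rangeRestrict x)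
  exact congrArg Subtype.val this

/-- The projection `M G` onto the column space of `M` fixes `u`. -/
def InCol (M : Matrix (Fin d) (Fin e) F) (G : Matrix (Fin e) (Fin d) F) (u : Fin d → F) : Prop :=
  M *ᵥ (G *ᵥ u) = u

/-- The projection `G M` onto the row space of `M` fixes `v`. -/
def InRow (M : Matrix (Fin d) (Fin e) F) (G : Matrix (Fin e) (Fin d) F) (v : Fin e → F) : Prop :=
  v ᵥ* G ᵥ* M = v

instance [DecidableEq F] (M : Matrix (Fin d) (Fin e) F) (G : Matrix (Fin e) (Fin d) F)
    (u : Fin d → F) : Decidable (InCol M G u) :=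
  inferInstanceAs (Decidable (M *ᵥ (G *ᵥ u) = u))

instance [DecidableEq F] (M : Matrix (Fin d) (Fin e) F) (G : Matrix (Fin e) (Fin d) F)
    (v : Fin e → F) : Decidable (InRow M G v) :=
  inferInstanceAs (Decidable (v ᵥ* G ᵥ* M = v))

theorem InCol.eq {M : Matrix (Fin d) (Fin e) F} {G : Matrix (Fin e) (Fin d) F} {u : Fin d → F}
    (h : InCol M G u) : M *ᵥ (G *ᵥ u) = u := h

theorem InRow.eq {M : Matrix (Fin d) (Fin e) F} {G : Matrix (Fin e) (Fin d) F} {v : Fin e → F}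
    (h : InRow M G v) : v ᵥ* G ᵥ* M = v := h

theorem inCol_mulVec {M : Matrix (Fin d) (Fin e) F} {G : Matrix (Fin e) (Fin d) F}
    (hG : M * G * M = M) (p : Fin e → F) : InCol M G (M *ᵥ p) := by
  rw [InCol, mulVec_mulVec, mulVec_mulVec, hG]

theorem inRow_vecMul {M : Matrix (Fin d) (Fin e) F} {G : Matrix (Fin e) (Fin d) F}
    (hG : M * G * M = M) (r : Fin d → F) : InRow M G (r ᵥ* M) := by
  rw [InRow, vecMul_vecMul, vecMul_vecMul, ← Matrix.mul_assoc, hG]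

theorem inRow_iff_inCol_transpose {M : Matrix (Fin d) (Fin e) F} {G : Matrix (Fin e) (Fin d) F}
    {v : Fin e → F} : InRow M G v ↔ InCol Mᵀ Gᵀ v := by
  rw [InCol, InRow, mulVec_transpose, mulVec_transpose]

theorem generalized_inverse_transpose {M : Matrix (Fin d) (Fin e) F}
    {G : Matrix (Fin e) (Fin d) F} (hG : M * G * M = M) : Mᵀ * Gᵀ * Mᵀ = Mᵀ := by
  rw [← transpose_mul, ← transpose_mul, ← Matrix.mul_assoc, hG]

theorem rank_sub_vecMulVec_le_of_inCol {M : Matrix (Fin d) (Fin e) F}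
    {G : Matrix (Fin e) (Fin d) F} {u : Fin d → F} (v : Fin e → F) (hu : InCol M G u) :
    (M - vecMulVec u v).rank ≤ M.rank := by
  apply Submodule.finrank_mono
  rintro _ ⟨x, rfl⟩
  rw [mulVecLin_apply, sub_vecMulVec_mulVec]
  refine ⟨x - (v ⬝ᵥ x) • (G *ᵥ u), ?_⟩
  rw [mulVecLin_apply, mulVec_sub, mulVec_smul, hu.eq]

/-- A left kernel vector y of M - u vᵀ satisfies yᵀM = (u·y) vᵀ. As v is not in the row space, u·y =
0, so y is in the left kernel of M. -/
theorem rank_le_rank_sub_vecMulVec_of_not_inRow {M : Matrix (Fin d) (Fin e) F}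
    {G : Matrix (Fin e) (Fin d) F} {v : Fin e → F} (u : Fin d → F) (hG : M * G * M = M)
    (hv : ¬ InRow M G v) : M.rank ≤ (M - vecMulVec u v).rank := by
  rw [← rank_transpose M, ← rank_transpose (M - vecMulVec u v), transpose_sub_vecMulVec]
  refine rank_le_rank_of_ker_le fun y hy => ?_
  rw [sub_vecMulVec_mulVec, sub_eq_zero, mulVec_transpose] at hy
  rw [mulVec_transpose, hy]
  by_cases h : u ⬝ᵥ y = 0
  · rw [h, zero_smul]
  · refine absurd ?_ hv
    have : v = ((u ⬝ᵥ y)⁻¹ • y) ᵥ* M := by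
      rw [smul_vecMul, hy, smul_smul, inv_mul_cancel₀ h, one_smul]
    rw [this]
    exact inRow_vecMul hG _

theorem rank_sub_vecMulVec_of_inCol_of_not_inRow {M : Matrix (Fin d) (Fin e) F}
    {G : Matrix (Fin e) (Fin d) F} {u : Fin d → F} {v : Fin e → F} (hG : M * G * M = M)
    (hu : InCol M G u) (hv : ¬ InRow M G v) : (M - vecMulVec u v).rank = M.rank :=
  le_antisymm (rank_sub_vecMulVec_le_of_inCol v hu)
    (rank_le_rank_sub_vecMulVec_of_not_inRow u hG hv)

theorem rank_sub_vecMulVec_of_not_inCol_of_inRow {M : Matrix (Fin d) (Fin e) F}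
    {G : Matrix (Fin e) (Fin d) F} {u : Fin d → F} {v : Fin e → F} (hG : M * G * M = M)
    (hu : ¬ InCol M G u) (hv : InRow M G v) : (M - vecMulVec u v).rank = M.rank := by
  rw [← rank_transpose M, ← rank_transpose (M - vecMulVec u v), transpose_sub_vecMulVec]
  refine rank_sub_vecMulVec_of_inCol_of_not_inRow (generalized_inverse_transpose hG)
    (inRow_iff_inCol_transpose.1 hv) ?_
  rwa [inRow_iff_inCol_transpose, transpose_transpose, transpose_transpose]

theorem exists_mulVec_eq_zero_of_not_inRow {M : Matrix (Fin d) (Fin e) F}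
    {G : Matrix (Fin e) (Fin d) F} {v : Fin e → F} (hG : M * G * M = M)
    (hv : ¬ InRow M G v) : ∃ x, M *ᵥ x = 0 ∧ v ⬝ᵥ x ≠ 0 := by
  by_contra! h
  apply hv
  apply dotProduct_eq
  intro w
  have h1 := h (w - G *ᵥ (M *ᵥ w)) (by
    rw [mulVec_sub, mulVec_mulVec, mulVec_mulVec, hG, sub_self])
  rw [dotProduct_sub, sub_eq_zero] at h1
  rw [h1, ← dotProduct_mulVec, ← dotProduct_mulVec]

/-- A kernel vector of `M` not orthogonal to `v` puts `u` in the column space of the difference,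
which therefore contains the column space of `M` properly. -/
theorem rank_sub_vecMulVec_of_not_inCol_of_not_inRow {M : Matrix (Fin d) (Fin e) F}
    {G : Matrix (Fin e) (Fin d) F} {u : Fin d → F} {v : Fin e → F} (hG : M * G * M = M)
    (hu : ¬ InCol M G u) (hv : ¬ InRow M G v) : (M - vecMulVec u v).rank = M.rank + 1 := by
  apply le_antisymm
  · rw [sub_eq_add_neg]
    refine (rank_add_le_add_rank _ _).trans ?_
    rw [rank_neg_matrix]
    exact Nat.add_le_add_left (rank_vecMulVec_le u v) _
  · obtain ⟨x, hx, hvx⟩ := exists_mulVec_eq_zero_of_not_inRow hG hv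
    have hmem : u ∈ LinearMap.range (M - vecMulVec u v).mulVecLin := by
      refine ⟨-(v ⬝ᵥ x)⁻¹ • x, ?_⟩
      rw [mulVecLin_apply, mulVec_smul, sub_vecMulVec_mulVec, hx, zero_sub, neg_smul, smul_neg,
        neg_neg, smul_smul, inv_mul_cancel₀ hvx, one_smul]
    apply Submodule.finrank_lt_finrank_of_lt
    refine lt_of_le_of_ne ?_ ?_
    · rintro _ ⟨p, rfl⟩
      have : M *ᵥ p = (M - vecMulVec u v) *ᵥ p + (v ⬝ᵥ p) • u := by
        rw [sub_vecMulVec_mulVec, sub_add_cancel]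
      rw [mulVecLin_apply, this]
      exact Submodule.add_mem _ ⟨p, rfl⟩ (Submodule.smul_mem _ _ hmem)
    · intro heq
      rw [← heq] at hmem
      obtain ⟨p, rfl⟩ := hmem
      exact hu (inCol_mulVec hG p)

/-- A kernel vector x of the difference has Mx = (v·x) u. Applying vᵀG gives v·x = (v·x)(vᵀGu), and
the pairing is not 1, so v·x = 0 and Mx = 0. -/
theorem rank_sub_vecMulVec_of_inCol_of_inRow {M : Matrix (Fin d) (Fin e) F}
    {G : Matrix (Fin e) (Fin d) F} {u : Fin d → F} {v : Fin e → F}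
    (hu : InCol M G u) (hv : InRow M G v) (ht : v ⬝ᵥ (G *ᵥ u) ≠ 1) :
    (M - vecMulVec u v).rank = M.rank := by
  refine le_antisymm (rank_sub_vecMulVec_le_of_inCol v hu) (rank_le_rank_of_ker_le fun x hx => ?_)
  rw [sub_vecMulVec_mulVec, sub_eq_zero] at hx
  have h1 : v ⬝ᵥ x = (v ⬝ᵥ x) * (v ⬝ᵥ (G *ᵥ u)) := by
    conv_lhs => rw [← hv.eq, ← dotProduct_mulVec, hx, dotProduct_smul, ← dotProduct_mulVec]
    rw [smul_eq_mul]
  have h2 : v ⬝ᵥ x = 0 := by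
    by_contra h0
    exact ht (mul_left_cancel₀ h0 (by rw [← h1, mul_one]))
  rw [hx, h2, zero_smul]

theorem rank_sub_vecMulVec_of_pairing_eq_one {M : Matrix (Fin d) (Fin e) F}
    {G : Matrix (Fin e) (Fin d) F} {u : Fin d → F} {v : Fin e → F}
    (hu : InCol M G u) (hv : InRow M G v) (ht : v ⬝ᵥ (G *ᵥ u) = 1) :
    (M - vecMulVec u v).rank + 1 = M.rank := by
  have h1 : (M - vecMulVec u v).rank < M.rank := by
    have := rank_sub_vecMulVec_lt M (G *ᵥ u) (v ᵥ* G) (by rw [hv.eq, ht])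
    rwa [hu.eq, hv.eq] at this
  have h2 := rank_add_le_add_rank (M - vecMulVec u v) (vecMulVec u v)
  rw [sub_add_cancel] at h2
  have h3 := rank_vecMulVec_le u v
  lia

end RankOne

/-! ### Sums over rank one matrices and over the neighbours of one of them. -/

section RankOneSums

variable {F : Type*} [Field F] [Fintype F] [DecidableEq F] {d e : ℕ}

open Matrix Module

/-- The rank one matrices. -/
def rankOnes (F : Type*) [Field F] [Fintype F] [DecidableEq F] (d e : ℕ) :
    Finset (Matrix (Fin d) (Fin e) F) := {z | z.rank = 1}

theorem mem_rankOnes {z : Matrix (Fin d) (Fin e) F} : z ∈ rankOnes F d e ↔ z.rank = 1 := by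
  simp [rankOnes]

theorem vecMulVec_mem_rankOnes {u : Fin d → F} {v : Fin e → F} (hu : u ≠ 0) (hv : v ≠ 0) :
    vecMulVec u v ∈ rankOnes F d e := mem_rankOnes.2 (rank_vecMulVec_eq_one hu hv)

omit [Fintype F] [DecidableEq F] in
theorem exists_smul_of_vecMulVec_eq {u u₀ : Fin d → F} {v v₀ : Fin e → F} (hu : u ≠ 0) (hv : v ≠ 0)
    (h : vecMulVec u v = vecMulVec u₀ v₀) : ∃ c : F, c ≠ 0 ∧ u = c • u₀ ∧ v = c⁻¹ • v₀ := by
  obtain ⟨i, hi⟩ := Function.ne_iff.1 hu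
  obtain ⟨j, hj⟩ := Function.ne_iff.1 hv
  simp only [Pi.zero_apply] at hi hj
  have hij : ∀ i j, u i * v j = u₀ i * v₀ j := fun i j => congrFun (congrFun h i) j
  have h0 : u₀ i * v₀ j ≠ 0 := by rw [← hij]; exact mul_ne_zero hi hj
  have hi0 := left_ne_zero_of_mul h0
  have hj0 := right_ne_zero_of_mul h0
  refine ⟨v₀ j / v j, div_ne_zero hj0 hj, ?_, ?_⟩
  · funext i'
    simp only [Pi.smul_apply, smul_eq_mul]
    field_simp
    linear_combination hij i' j
  · funext j'
    simp only [Pi.smul_apply, smul_eq_mul]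
    have h1 := hij i j'
    have h2 := hij i j
    field_simp
    apply mul_left_cancel₀ (mul_ne_zero hi hi0)
    linear_combination (u₀ i * v₀ j) * h1 - u₀ i * v₀ j' * h2

/-- Each rank one matrix arises from exactly q - 1 pairs, namely (c u, c⁻¹ v) with c ≠ 0. -/
theorem sum_smul_rankOnes {N : Type*} [AddCommMonoid N] (g : Matrix (Fin d) (Fin e) F → N) :
    (Fintype.card F - 1) • ∑ z ∈ rankOnes F d e, g z =
      ∑ u ∈ Finset.univ.erase (0 : Fin d → F), ∑ v ∈ Finset.univ.erase (0 : Fin e → F),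
        g (vecMulVec u v) := by
  rw [← Finset.sum_product']
  rw [← Finset.sum_fiberwise_of_maps_to (t := rankOnes F d e) 
    (g := fun p : (Fin d → F) × (Fin e → F) => vecMulVec p.1 p.2)]
  · rw [← Finset.sum_nsmul]
    refine Finset.sum_congr rfl fun z hz => ?_
    obtain ⟨u, v, hu, hv, rfl⟩ := exists_vecMulVec_of_rank_eq_one (mem_rankOnes.1 hz)
    rw [Finset.sum_congr rfl (g := fun _ => g (vecMulVec u v))
      (fun p hp => by rw [(Finset.mem_filter.1 hp).2]), Finset.sum_const]
    congr 1
    symm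
    rw [← Finset.card_univ, ← Finset.card_erase_of_mem (Finset.mem_univ (0 : F))]
    symm
    refine Finset.card_bij (fun c _ => (c • u, c⁻¹ • v)) ?_ ?_ ?_
    · intro c hc
      have hc0 : c ≠ 0 := Finset.ne_of_mem_erase hc
      simp [hc0, hu, hv, smul_vecMulVec, vecMulVec_smul, smul_smul]
    · intro c hc c' hc' h
      exact smul_left_injective F hu (Prod.ext_iff.1 h).1
    · rintro ⟨u', v'⟩ h
      simp only [Finset.mem_filter, Finset.mem_product, Finset.mem_erase, Finset.mem_univ,
        and_true] at h
      obtain ⟨c, hc, rfl, rfl⟩ := exists_smul_of_vecMulVec_eq h.1.1 h.1.2 h.2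
      exact ⟨c, by simp [hc], rfl⟩
  · intro p hp
    simp only [Finset.mem_product, Finset.mem_erase, Finset.mem_univ, and_true] at hp
    exact vecMulVec_mem_rankOnes hp.1 hp.2

omit [Fintype F] [DecidableEq F] in
/-- Two rank one matrices whose difference has rank at most one share their column space or their
row space. -/
theorem exists_eq_vecMulVec_of_sub_eq {a p r : Fin d → F} {b q s : Fin e → F}
    (ha : a ≠ 0) (hb : b ≠ 0) (h : vecMulVec p q - vecMulVec a b = vecMulVec r s) :
    (∃ v, vecMulVec p q = vecMulVec a v) ∨ ∃ u, vecMulVec p q = vecMulVec u b := by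
  have hx : ∀ x, (q ⬝ᵥ x) • p - (b ⬝ᵥ x) • a = (s ⬝ᵥ x) • r := by
    intro x
    have := congrArg (· *ᵥ x) h
    simpa only [sub_mulVec, vecMulVec_mulVec, op_smul_eq_smul] using this
  by_cases hqb : ∀ i j, q i * b j = q j * b i
  · right
    obtain ⟨j, hj⟩ := Function.ne_iff.1 hb
    simp only [Pi.zero_apply] at hj
    refine ⟨(q j / b j) • p, ?_⟩
    ext i i'
    simp only [vecMulVec_apply, Pi.smul_apply, smul_eq_mul]
    field_simp
    linear_combination p i * hqb i' j
  · left
    push Not at hqb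
    obtain ⟨i, j, hij⟩ := hqb
    set w : F := q i * b j - q j * b i with hw
    have hw0 : w ≠ 0 := sub_ne_zero.2 hij
    -- The first test vector is orthogonal to `b` and the second to `q`; they show that `p` and `a`
    -- are both multiples of `r`.
    have h1 := hx (Pi.single i (b j) - Pi.single j (b i))
    have h2 := hx (Pi.single i (q j) - Pi.single j (q i))
    simp only [dotProduct_sub, dotProduct_single] at h1 h2
    rw [show b i * b j - b j * b i = 0 by ring, ← hw, zero_smul, sub_zero] at h1
    rw [show q i * q j - q j * q i = 0 by ring, zero_smul, zero_sub, ← neg_smul,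
      show -(b i * q j - b j * q i) = w by rw [hw]; ring] at h2
    set α := s i * b j - s j * b i
    set β := s i * q j - s j * q i
    have hα : p = (w⁻¹ * α) • r := by
      rw [mul_smul, ← h1, smul_smul, inv_mul_cancel₀ hw0, one_smul]
    have hβ : a = (w⁻¹ * β) • r := by
      rw [mul_smul, ← h2, smul_smul, inv_mul_cancel₀ hw0, one_smul]
    have hβ0 : w⁻¹ * β ≠ 0 := by
      intro h0
      rw [h0, zero_smul] at hβ
      exact ha hβ
    refine ⟨((w⁻¹ * α) * (w⁻¹ * β)⁻¹) • q, ?_⟩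
    rw [vecMulVec_smul, hα, hβ, smul_vecMulVec, smul_vecMulVec, smul_smul, mul_assoc,
      inv_mul_cancel₀ hβ0, mul_one]

/-- The neighbours of u vᵀ together with u vᵀ itself form the union of the matrices with the same
column space and those with the same row space; the intersection is the set of nonzero multiples of
u vᵀ. -/
theorem sum_neighbors_rankOnes {N : Type*} [AddCommGroup N] (g : Matrix (Fin d) (Fin e) F → N)
    {u : Fin d → F} {v : Fin e → F} (hu : u ≠ 0) (hv : v ≠ 0) :
    ∑ z ∈ rankOnes F d e with (z - vecMulVec u v).rank = 1, g z =
      ∑ v' ∈ Finset.univ.erase (0 : Fin e → F), g (vecMulVec u v') +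
      ∑ u' ∈ Finset.univ.erase (0 : Fin d → F), g (vecMulVec u' v) -
      ∑ c ∈ Finset.univ.erase (0 : F), g (c • vecMulVec u v) - g (vecMulVec u v) := by
  have inj1 : Function.Injective (fun v' : Fin e → F => vecMulVec u v') := by
    intro v1 v2 h
    obtain ⟨i, hi⟩ := Function.ne_iff.1 hu
    funext j
    exact mul_left_cancel₀ hi (congrFun (congrFun h i) j)
  have inj2 : Function.Injective (fun u' : Fin d → F => vecMulVec u' v) := by
    intro u1 u2 h
    obtain ⟨j, hj⟩ := Function.ne_iff.1 hv
    funext i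
    exact mul_right_cancel₀ hj (congrFun (congrFun h i) j)
  have huv : vecMulVec u v ≠ 0 := by
    intro h
    have := rank_vecMulVec_eq_one hu hv
    rw [h, rank_zero] at this
    exact zero_ne_one this
  have inj3 : Function.Injective (fun c : F => c • vecMulVec u v) := smul_left_injective F huv
  rw [← Finset.sum_image (f := g) (g := fun v' => vecMulVec u v') inj1.injOn,
    ← Finset.sum_image (f := g) (g := fun u' => vecMulVec u' v) inj2.injOn,
    ← Finset.sum_image (f := g) (g := fun c : F => c • vecMulVec u v) inj3.injOn,
    ← Finset.sum_union_inter, eq_sub_iff_add_eq, eq_sub_iff_add_eq]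
  congr 1
  · rw [add_comm, ← Finset.sum_insert (by simp)]
    congr 1
    ext z
    simp only [Finset.mem_insert, Finset.mem_filter, mem_rankOnes, Finset.mem_union,
      Finset.mem_image, Finset.mem_erase, Finset.mem_univ, and_true]
    constructor
    · rintro (rfl | ⟨h1, h2⟩)
      · exact Or.inl ⟨v, hv, rfl⟩
      · obtain ⟨p, q, hp, hq, rfl⟩ := exists_vecMulVec_of_rank_eq_one h1
        obtain ⟨r, s, -, -, hrs⟩ := exists_vecMulVec_of_rank_eq_one h2
        rcases exists_eq_vecMulVec_of_sub_eq hu hv hrs with ⟨v', h⟩ | ⟨u', h⟩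
        · refine Or.inl ⟨v', ?_, h.symm⟩
          rintro rfl
          have : vecMulVec p q = 0 := by rw [h]; ext; simp [vecMulVec_apply]
          rw [this, rank_zero] at h1
          exact zero_ne_one h1
        · refine Or.inr ⟨u', ?_, h.symm⟩
          rintro rfl
          rw [h, zero_vecMulVec, rank_zero] at h1
          exact zero_ne_one h1
    · rintro (⟨v', hv', rfl⟩ | ⟨u', hu', rfl⟩)
      · rw [← vecMulVec_sub]
        by_cases h : v' - v = 0
        · left; rw [sub_eq_zero.1 h]
        · exact Or.inr ⟨rank_vecMulVec_eq_one hu hv', rank_vecMulVec_eq_one hu h⟩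
      · rw [← sub_vecMulVec]
        by_cases h : u' - u = 0
        · left; rw [sub_eq_zero.1 h]
        · exact Or.inr ⟨rank_vecMulVec_eq_one hu' hv, rank_vecMulVec_eq_one h hv⟩
  · congr 1
    ext z
    simp only [Finset.mem_inter, Finset.mem_image, Finset.mem_erase, Finset.mem_univ, and_true]
    constructor
    · rintro ⟨c, hc, rfl⟩
      exact ⟨⟨c • v, smul_ne_zero hc hv, vecMulVec_smul _ _ _⟩,
        ⟨c • u, smul_ne_zero hc hu, smul_vecMulVec _ _ _⟩⟩
    · rintro ⟨⟨v', hv', rfl⟩, ⟨u', hu', h⟩⟩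
      obtain ⟨c, hc, rfl, h2⟩ := exists_smul_of_vecMulVec_eq hu' hv h
      exact ⟨c, hc, by rw [← h, smul_vecMulVec]⟩

end RankOneSums

/-! ### Additive characters, eigenvalues and the projections onto spans of characters. -/

section Characters

variable {F : Type*} [Field F] [Fintype F] {d e : ℕ}

open Matrix Module

/-- A nontrivial complex additive character of a finite field. -/
def fieldChar (F : Type*) [Field F] [Fintype F] : AddChar F ℂ :=
  AddChar.FiniteField.primitiveChar_to_Complex F

theorem exists_fieldChar_ne_one : ∃ x : F, fieldChar F x ≠ 1 := by
  have h := (AddChar.FiniteField.primitiveChar_to_Complex_isPrimitive F) (one_ne_zero)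
  obtain ⟨x, hx⟩ := AddChar.ne_one_iff.1 h
  exact ⟨1 * x, hx⟩

open Classical in
theorem sum_fieldChar_linearMap {V : Type*} [AddCommGroup V] [Module F V] [Fintype V]
    (f : V →ₗ[F] F) : ∑ x, fieldChar F (f x) = if f = 0 then (Fintype.card V : ℂ) else 0 := by
  have h := AddChar.sum_eq_ite ((fieldChar F).compAddMonoidHom f.toAddMonoidHom)
  refine Eq.trans h ?_
  congr 1
  rw [eq_iff_iff, AddChar.eq_zero_iff]
  constructor
  · intro h1
    by_contra hf
    obtain ⟨x, hx⟩ := exists_fieldChar_ne_one (F := F)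
    obtain ⟨v, hv⟩ : ∃ v, f v ≠ 0 := by
      by_contra! h0
      exact hf (LinearMap.ext h0)
    apply hx
    have := h1 ((x / f v) • v)
    rwa [AddChar.compAddMonoidHom_apply, LinearMap.toAddMonoidHom_coe, map_smul, smul_eq_mul,
      div_mul_cancel₀ _ hv] at this
  · rintro rfl x
    simp

open Classical in
theorem sum_fieldChar_dotProduct (w : Fin d → F) :
    ∑ v, fieldChar F (w ⬝ᵥ v) = if w = 0 then (Fintype.card F : ℂ) ^ d else 0 := by
  have h := sum_fieldChar_linearMap (dotProductBilin F F w)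
  simp only [dotProductBilin_apply_apply] at h
  rw [h]
  congr 1
  · rw [eq_iff_iff]
    constructor
    · intro h0
      exact dotProduct_eq_zero w fun v => LinearMap.congr_fun h0 v
    · rintro rfl
      ext v
      simp
  · simp

/-- The additive character `z ↦ ψ (tr (Bᵀ z))`. -/
def matChar (B : Matrix (Fin d) (Fin e) F) : AddChar (Matrix (Fin d) (Fin e) F) ℂ :=
  (fieldChar F).compAddMonoidHom (AddMonoidHom.mk' (fun z => (Bᵀ * z).trace) fun z w => by
    rw [Matrix.mul_add, trace_add])

theorem matChar_apply (B z : Matrix (Fin d) (Fin e) F) :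
    matChar B z = fieldChar F (Bᵀ * z).trace := rfl

theorem matChar_comm (B z : Matrix (Fin d) (Fin e) F) : matChar B z = matChar z B := by
  rw [matChar_apply, matChar_apply, ← trace_transpose (Bᵀ * z), transpose_mul, transpose_transpose]

theorem matChar_add_left (B C z : Matrix (Fin d) (Fin e) F) :
    matChar (B + C) z = matChar B z * matChar C z := by
  rw [matChar_comm, AddChar.map_add_eq_mul, matChar_comm z, matChar_comm z]

theorem matChar_neg_left (B z : Matrix (Fin d) (Fin e) F) : matChar (-B) z = matChar B (-z) := by
  rw [matChar_apply, matChar_apply, transpose_neg, Matrix.neg_mul, Matrix.mul_neg]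

theorem matChar_vecMulVec (a : Fin d → F) (b : Fin e → F) (z : Matrix (Fin d) (Fin e) F) :
    matChar (vecMulVec a b) z = fieldChar F (a ⬝ᵥ (z *ᵥ b)) := by
  rw [matChar_apply, transpose_vecMulVec, vecMulVec_mul, trace_vecMulVec, dotProduct_comm,
    dotProduct_mulVec]

theorem matChar_vecMulVec_vecMulVec (a u : Fin d → F) (b v : Fin e → F) :
    matChar (vecMulVec a b) (vecMulVec u v) = fieldChar F ((a ⬝ᵥ u) * (b ⬝ᵥ v)) := by
  rw [matChar_vecMulVec, vecMulVec_mulVec, op_smul_eq_smul, dotProduct_smul, smul_eq_mul,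
    mul_comm, dotProduct_comm v]

theorem conj_matChar (B z : Matrix (Fin d) (Fin e) F) :
    (starRingEnd ℂ) (matChar B z) = matChar B (-z) :=
  (AddChar.map_neg_eq_conj _ _).symm

variable [DecidableEq F]

theorem sum_matChar (B : Matrix (Fin d) (Fin e) F) :
    ∑ z, matChar B z =
      if B = 0 then (Fintype.card (Matrix (Fin d) (Fin e) F) : ℂ) else 0 := by
  classical
  have h := sum_fieldChar_linearMap (traceLinearMap (Fin e) F F ∘ₗ mulLeftLinearMap (Fin e) F Bᵀ)
  refine Eq.trans h ?_
  by_cases hB : B = 0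
  · rw [if_pos hB, if_pos]
    subst hB
    ext z
    simp
  · rw [if_neg hB, if_neg]
    intro h0
    apply hB
    rw [← transpose_eq_zero, ext_iff_trace_mul_right]
    intro z
    rw [Matrix.zero_mul, trace_zero]
    exact LinearMap.congr_fun h0 z

theorem card_filter_vecMul_eq_zero (B : Matrix (Fin d) (Fin e) F) :
    (Finset.univ.filter fun u : Fin d → F => u ᵥ* B = 0).card = Fintype.card F ^ (d - B.rank) := by
  have h1 := rank_add_finrank_ker Bᵀ
  rw [rank_transpose] at h1
  have h2 : finrank F (LinearMap.ker Bᵀ.mulVecLin) = d - B.rank := by lia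
  rw [← h2, ← Nat.card_eq_fintype_card, ← Module.natCard_eq_pow_finrank (K := F),
    ← Fintype.card_subtype, ← Nat.card_eq_fintype_card]
  refine Nat.card_congr (Equiv.subtypeEquivRight fun u => ?_)
  rw [LinearMap.mem_ker, mulVecLin_apply, mulVec_transpose]

/-- The eigenvalues of the bilinear forms graph. -/
def bilinearEigenvalue (F : Type*) [Fintype F] (d e r : ℕ) : ℝ :=
  ((Fintype.card F : ℝ) ^ e * ((Fintype.card F : ℝ) ^ (d - r) - 1) -
    ((Fintype.card F : ℝ) ^ d - 1)) / ((Fintype.card F : ℝ) - 1)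

omit [DecidableEq F] in
theorem one_lt_card_real : (1 : ℝ) < Fintype.card F := by
  exact_mod_cast Fintype.one_lt_card

theorem sum_erase_fieldChar_dotProduct (w : Fin d → F) :
    ∑ v ∈ Finset.univ.erase 0, fieldChar F (w ⬝ᵥ v) =
      (if w = 0 then (Fintype.card F : ℂ) ^ d else 0) - 1 := by
  classical
  rw [Finset.sum_erase_eq_sub (Finset.mem_univ _), sum_fieldChar_dotProduct, dotProduct_zero,
    AddChar.map_zero_eq_one]
  congr

/-- For fixed u ≠ 0 the sum over v ≠ 0 is q^e - 1 if uᵀB = 0 and -1 otherwise. There are q^(d-r) - 1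
nonzero u of the first kind, where r is the rank of `B`. -/
theorem sum_matChar_rankOnes (B : Matrix (Fin d) (Fin e) F) :
    ∑ z ∈ rankOnes F d e, matChar B z = (bilinearEigenvalue F d e B.rank : ℂ) := by
  have h := sum_smul_rankOnes (fun z : Matrix (Fin d) (Fin e) F => matChar B z)
  have hq : 1 < Fintype.card F := Fintype.one_lt_card
  have h1 : ∀ u : Fin d → F, ∑ v ∈ Finset.univ.erase 0, matChar B (vecMulVec u v) =
      (if u ᵥ* B = 0 then (Fintype.card F : ℂ) ^ e else 0) - 1 := by
    intro u
    rw [← sum_erase_fieldChar_dotProduct]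
    refine Finset.sum_congr rfl fun v _ => ?_
    rw [matChar_comm, matChar_vecMulVec, dotProduct_mulVec]
  simp only [h1] at h
  rw [Finset.sum_erase_eq_sub (Finset.mem_univ _), Finset.sum_sub_distrib, ← Finset.sum_filter,
    Finset.sum_const, card_filter_vecMul_eq_zero] at h
  simp only [zero_vecMul, if_true, Finset.sum_const, Finset.card_univ, nsmul_eq_mul,
    Fintype.card_fun, Fintype.card_fin, Nat.cast_pow] at h
  rw [Nat.cast_sub hq.le] at h
  have hq' : (Fintype.card F : ℂ) - 1 ≠ 0 := by
    rw [sub_ne_zero]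
    exact_mod_cast hq.ne'
  rw [bilinearEigenvalue]
  push_cast at h ⊢
  rw [eq_div_iff hq', mul_comm, h]
  ring

omit [DecidableEq F] in
theorem bilinearEigenvalue_lt {r s : ℕ} (hrs : r < s) (hs : s ≤ d) :
    bilinearEigenvalue F d e s < bilinearEigenvalue F d e r := by
  have hq : (1 : ℝ) < Fintype.card F := one_lt_card_real
  unfold bilinearEigenvalue
  have : (Fintype.card F : ℝ) ^ (d - s) < (Fintype.card F : ℝ) ^ (d - r) :=
    pow_lt_pow_right₀ hq (by lia)
  have h0 : (0 : ℝ) < Fintype.card F := by linarith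
  have h1 : (0 : ℝ) < (Fintype.card F : ℝ) - 1 := by linarith
  gcongr

/-- The matrix `|X|⁻¹ ∑_{B ∈ T} χ_B(z - w)`, which projects onto the span of the characters `χ_B`,
`B ∈ T`. -/
def dualProj (T : Finset (Matrix (Fin d) (Fin e) F)) :
    Matrix (Matrix (Fin d) (Fin e) F) (Matrix (Fin d) (Fin e) F) ℝ :=
  Matrix.of fun z w => (Fintype.card (Matrix (Fin d) (Fin e) F) : ℝ)⁻¹ *
    (∑ B ∈ T, matChar B (z - w)).re

omit [DecidableEq F] in
-- Conjugation sends χ_B to χ_{-B}, so the sum over a symmetric set is real and taking the real part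
-- loses nothing.
theorem dualProj_apply {T : Finset (Matrix (Fin d) (Fin e) F)} (hT : ∀ B ∈ T, -B ∈ T)
    (z w : Matrix (Fin d) (Fin e) F) :
    (dualProj T z w : ℂ) = (Fintype.card (Matrix (Fin d) (Fin e) F) : ℂ)⁻¹ *
      ∑ B ∈ T, matChar B (z - w) := by
  have h : ∑ B ∈ T, matChar B (z - w) = ((∑ B ∈ T, matChar B (z - w)).re : ℂ) := by
    symm
    rw [← Complex.conj_eq_iff_re, map_sum]
    refine Finset.sum_nbij' (fun B => -B) (fun B => -B) hT hT (by simp) (by simp) ?_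
    intro B _
    rw [conj_matChar, matChar_neg_left]
  conv_rhs => rw [h]
  simp [dualProj]

/-- The matrices of rank `r`. -/
def rankLayer (F : Type*) [Field F] [Fintype F] [DecidableEq F] (d e r : ℕ) :
    Finset (Matrix (Fin d) (Fin e) F) := {z | z.rank = r}

theorem mem_rankLayer {r : ℕ} {z : Matrix (Fin d) (Fin e) F} :
    z ∈ rankLayer F d e r ↔ z.rank = r := by
  simp [rankLayer]

theorem neg_mem_rankLayer {r : ℕ} : ∀ z ∈ rankLayer F d e r, -z ∈ rankLayer F d e r := by
  intro z hz
  rw [mem_rankLayer] at hz ⊢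
  rw [rank_neg_matrix, hz]

theorem realAdjMatrix_apply (z w : Matrix (Fin d) (Fin e) F) :
    realAdjMatrix (bilinearFormsGraph F d e) z w = if z - w ∈ rankOnes F d e then 1 else 0 := by
  simp only [realAdjMatrix, SimpleGraph.adjMatrix_apply, bilinearFormsGraph_adj, mem_rankOnes]

theorem realAdjMatrix_isSymm : (realAdjMatrix (bilinearFormsGraph F d e)).IsSymm := by
  ext z w
  simp only [transpose_apply, realAdjMatrix_apply, mem_rankOnes, rank_sub_comm w z]

omit [DecidableEq F] in
theorem dualProj_isSymm {T : Finset (Matrix (Fin d) (Fin e) F)} (hT : ∀ B ∈ T, -B ∈ T) :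
    (dualProj T).IsSymm := by
  ext z w
  rw [transpose_apply, ← Complex.ofReal_inj, dualProj_apply hT, dualProj_apply hT]
  congr 1
  refine Finset.sum_nbij' (fun B => -B) (fun B => -B) hT hT (by simp) (by simp) ?_
  intro B _
  rw [matChar_neg_left, neg_sub]

/-- In a Cayley graph a character is an eigenvector whose eigenvalue is its sum over the connection
set, here the rank one matrices. -/
theorem realAdjMatrix_mul_dualProj (r : ℕ) :
    realAdjMatrix (bilinearFormsGraph F d e) * dualProj (rankLayer F d e r) =
      bilinearEigenvalue F d e r • dualProj (rankLayer F d e r) := by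
  ext z w
  rw [← Complex.ofReal_inj, mul_apply, Matrix.smul_apply, smul_eq_mul]
  push_cast
  simp only [dualProj_apply neg_mem_rankLayer, realAdjMatrix_apply]
  rw [← (Equiv.subLeft z).sum_comp]
  simp only [Equiv.subLeft_apply, sub_sub_cancel, apply_ite Complex.ofReal, Complex.ofReal_one,
    Complex.ofReal_zero]
  simp only [ite_mul, one_mul, zero_mul, Finset.sum_ite_mem, Finset.univ_inter]
  rw [← Finset.mul_sum, mul_left_comm]
  congr 1
  rw [Finset.sum_comm, Finset.mul_sum]
  refine Finset.sum_congr rfl fun B hB => ?_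
  have h : ∀ m, matChar B (z - m - w) = matChar (-B) m * matChar B (z - w) := by
    intro m
    rw [matChar_neg_left, ← AddChar.map_add_eq_mul]
    congr 1
    abel
  simp only [h]
  rw [← Finset.sum_mul, sum_matChar_rankOnes, rank_neg_matrix, mem_rankLayer.1 hB]

theorem sum_dualProj_rankLayer :
    ∑ r ∈ Finset.range (d + 1), dualProj (rankLayer F d e r) = 1 := by
  ext z w
  rw [← Complex.ofReal_inj, Matrix.sum_apply]
  push_cast
  simp only [dualProj_apply neg_mem_rankLayer]
  rw [← Finset.mul_sum]
  unfold rankLayer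
  rw [Finset.sum_fiberwise_of_maps_to]
  · simp only [matChar_comm _ (z - w)]
    rw [sum_matChar, one_apply]
    by_cases h : z = w
    · simp [h]
    · simp [h, sub_eq_zero]
  · intro B _
    rw [Finset.mem_range]
    have := rank_le_height B
    lia

end Characters

/-! ### The eigenvalue θ_1 and its idempotent. -/

section Spectrum

open Matrix Module

theorem mem_graphEigenvalues {X : Type*} [Fintype X] [DecidableEq X] {G : SimpleGraph X} {μ : ℝ} :
    μ ∈ graphEigenvalues G ↔ ∃ v, v ≠ 0 ∧ realAdjMatrix G *ᵥ v = μ • v := by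
  rw [graphEigenvalues, Multiset.mem_toFinset, Polynomial.mem_roots
    (minpoly.ne_zero (Matrix.isIntegral _)), ← Matrix.minpoly_toLin',
    ← Module.End.hasEigenvalue_iff_isRoot]
  constructor
  · intro h
    obtain ⟨v, hv⟩ := h.exists_hasEigenvector
    exact ⟨v, hv.2, by simpa using hv.apply_eq_smul⟩
  · rintro ⟨v, hv, h⟩
    exact Module.End.hasEigenvalue_of_hasEigenvector
      ⟨Module.End.mem_eigenspace_iff.2 (by simpa using h), hv⟩

theorem orderedEigenvalue_one_eq {X : Type*} [Fintype X] [DecidableEq X] {G : SimpleGraph X}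
    {a b : ℝ} (ha : a ∈ graphEigenvalues G) (hb : b ∈ graphEigenvalues G) (hab : b < a)
    (h : ∀ c ∈ graphEigenvalues G, c = a ∨ c ≤ b) : orderedEigenvalue G 1 = b := by
  have h1 : graphEigenvalues G =
      insert a (insert b (((graphEigenvalues G).erase a).erase b)) := by
    rw [Finset.insert_erase, Finset.insert_erase ha]
    exact Finset.mem_erase.2 ⟨hab.ne, hb⟩
  rw [orderedEigenvalue, h1, Finset.sort_insert, Finset.sort_insert]
  · rfl
  · intro c hc
    simp only [Finset.mem_erase] at hc
    exact (h c hc.2.2).resolve_left hc.2.1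
  · simp
  · intro c hc
    simp only [Finset.mem_insert, Finset.mem_erase] at hc
    rcases hc with rfl | hc
    · exact hab.le
    · exact ((h c hc.2.2).resolve_left hc.2.1).trans hab.le
  · simp [hab.ne']

variable {F : Type*} [Field F] [Fintype F] [DecidableEq F] {d e : ℕ}

omit [DecidableEq F] in
theorem dualProj_ne_zero {T : Finset (Matrix (Fin d) (Fin e) F)} (hT : ∀ B ∈ T, -B ∈ T)
    (hne : T.Nonempty) : dualProj T ≠ 0 := by
  intro h
  have h1 := dualProj_apply hT 0 0
  rw [h] at h1
  simp at h1
  exact hne.ne_empty h1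

theorem mulVec_dualProj (r : ℕ) (v : Matrix (Fin d) (Fin e) F → ℝ) :
    realAdjMatrix (bilinearFormsGraph F d e) *ᵥ (dualProj (rankLayer F d e r) *ᵥ v) =
      bilinearEigenvalue F d e r • (dualProj (rankLayer F d e r) *ᵥ v) := by
  rw [mulVec_mulVec, realAdjMatrix_mul_dualProj, smul_mulVec]

theorem dualProj_mulVec_mulVec (r : ℕ) (v : Matrix (Fin d) (Fin e) F → ℝ) :
    dualProj (rankLayer F d e r) *ᵥ (realAdjMatrix (bilinearFormsGraph F d e) *ᵥ v) =
      bilinearEigenvalue F d e r • (dualProj (rankLayer F d e r) *ᵥ v) := by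
  have h := congrArg transpose (realAdjMatrix_mul_dualProj (F := F) (d := d) (e := e) r)
  rw [transpose_mul, transpose_smul, realAdjMatrix_isSymm, dualProj_isSymm neg_mem_rankLayer] at h
  rw [mulVec_mulVec, h, smul_mulVec]

theorem sum_dualProj_mulVec (v : Matrix (Fin d) (Fin e) F → ℝ) :
    ∑ r ∈ Finset.range (d + 1), dualProj (rankLayer F d e r) *ᵥ v = v := by
  rw [← Matrix.sum_mulVec, sum_dualProj_rankLayer, one_mulVec]

theorem bilinearEigenvalue_mem {r : ℕ} (h : (rankLayer F d e r).Nonempty) :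
    bilinearEigenvalue F d e r ∈ graphEigenvalues (bilinearFormsGraph F d e) := by
  rw [mem_graphEigenvalues]
  obtain ⟨v, hv⟩ : ∃ v, dualProj (rankLayer F d e r) *ᵥ v ≠ 0 := by
    by_contra! h0
    apply dualProj_ne_zero neg_mem_rankLayer h
    apply Matrix.mulVec_injective
    funext v
    rw [h0, zero_mulVec]
  exact ⟨_, hv, mulVec_dualProj r v⟩

theorem exists_eq_bilinearEigenvalue {μ : ℝ}
    (h : μ ∈ graphEigenvalues (bilinearFormsGraph F d e)) :
    ∃ r ≤ d, μ = bilinearEigenvalue F d e r := by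
  obtain ⟨v, hv, hμ⟩ := mem_graphEigenvalues.1 h
  obtain ⟨r, hr, hrv⟩ : ∃ r ∈ Finset.range (d + 1), dualProj (rankLayer F d e r) *ᵥ v ≠ 0 := by
    by_contra! h0
    apply hv
    rw [← sum_dualProj_mulVec v]
    exact Finset.sum_eq_zero h0
  refine ⟨r, by simpa [Nat.lt_succ_iff] using hr, ?_⟩
  have h1 := dualProj_mulVec_mulVec r v
  rw [hμ, mulVec_smul] at h1
  exact smul_left_injective ℝ hrv h1

theorem orderedEigenvalue_bilinearFormsGraph (hd : 0 < d) (he : 0 < e) :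
    orderedEigenvalue (bilinearFormsGraph F d e) 1 = bilinearEigenvalue F d e 1 := by
  apply orderedEigenvalue_one_eq (a := bilinearEigenvalue F d e 0)
  · exact bilinearEigenvalue_mem ⟨0, mem_rankLayer.2 rank_zero⟩
  · refine bilinearEigenvalue_mem ⟨vecMulVec (Pi.single ⟨0, hd⟩ 1) (Pi.single ⟨0, he⟩ 1), ?_⟩
    rw [mem_rankLayer]
    apply rank_vecMulVec_eq_one <;> simp
  · exact bilinearEigenvalue_lt Nat.zero_lt_one hd
  · intro c hc
    obtain ⟨r, hr, rfl⟩ := exists_eq_bilinearEigenvalue hc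
    rcases r with _ | _ | r
    · exact Or.inl rfl
    · exact Or.inr le_rfl
    · exact Or.inr (bilinearEigenvalue_lt (by lia) hr).le

theorem rankLayer_one : rankLayer F d e 1 = rankOnes F d e := rfl

theorem neg_mem_rankOnes : ∀ z ∈ rankOnes F d e, -z ∈ rankOnes F d e := neg_mem_rankLayer

/-- A vector is the sum of its components in the rank layers r ≤ d. These are eigenvectors with
distinct eigenvalues, and only the layer r = 1 belongs to θ_1. -/
theorem bilinearIdempotent_eq_dualProj (hd : 0 < d) (he : 0 < e) :
    bilinearIdempotent F d e = dualProj (rankOnes F d e) := by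
  apply Matrix.mulVec_injective
  funext v
  rw [bilinearIdempotent, orderedEigenvalue_bilinearFormsGraph hd he]
  conv_lhs => rw [← sum_dualProj_mulVec v, mulVec_sum]
  rw [Finset.sum_eq_single 1, rankLayer_one]
  · exact primitiveIdempotent_mulVec_self _ _ _ (mulVec_dualProj 1 v)
  · intro r hr hr1
    refine primitiveIdempotent_mulVec_of_ne _ realAdjMatrix_isSymm _ _ ?_ _ (mulVec_dualProj r v)
    rw [Finset.mem_range] at hr
    rcases lt_or_gt_of_ne hr1 with h | h
    · exact (bilinearEigenvalue_lt h hd).ne'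
    · exact (bilinearEigenvalue_lt h (by lia)).ne
  · intro h
    rw [Finset.mem_range] at h
    lia

end Spectrum

/-! ### The Norton product on the Fourier side. -/

section Fourier

open Matrix Module

variable {F : Type*} [Field F] [Fintype F] [DecidableEq F] {d e : ℕ}

/-- The Fourier transform on the additive group of matrices. -/
def matFourier (u : Matrix (Fin d) (Fin e) F → ℝ) (B : Matrix (Fin d) (Fin e) F) : ℂ :=
  ∑ z, matChar B (-z) * (u z : ℂ)

theorem matFourier_single (z B : Matrix (Fin d) (Fin e) F) :
    matFourier (Pi.single z 1) B = matChar B (-z) := by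
  rw [matFourier, Finset.sum_eq_single z]
  · simp
  · intro w _ hw
    simp [hw]
  · simp

theorem matFourier_charVec (Ω : Finset (Matrix (Fin d) (Fin e) F)) (B : Matrix (Fin d) (Fin e) F) :
    matFourier (charVec Ω) B = ∑ z ∈ Ω, matChar B (-z) := by
  rw [matFourier, charVec]
  simp only [Finset.sum_apply, Complex.ofReal_sum, Finset.mul_sum]
  rw [Finset.sum_comm]
  refine Finset.sum_congr rfl fun z _ => ?_
  rw [← matFourier_single]
  rfl

omit [DecidableEq F] in
theorem matFourier_add (u v : Matrix (Fin d) (Fin e) F → ℝ) (B : Matrix (Fin d) (Fin e) F) :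
    matFourier (u + v) B = matFourier u B + matFourier v B := by
  simp [matFourier, mul_add, Finset.sum_add_distrib]

omit [DecidableEq F] in
theorem matFourier_smul (c : ℝ) (u : Matrix (Fin d) (Fin e) F → ℝ)
    (B : Matrix (Fin d) (Fin e) F) : matFourier (c • u) B = c * matFourier u B := by
  simp only [matFourier, Finset.mul_sum, Pi.smul_apply, smul_eq_mul, Complex.ofReal_mul]
  exact Finset.sum_congr rfl fun z _ => by ring

omit [DecidableEq F] in
theorem dualProj_mulVec_apply {T : Finset (Matrix (Fin d) (Fin e) F)} (hT : ∀ B ∈ T, -B ∈ T)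
    (u : Matrix (Fin d) (Fin e) F → ℝ) (z : Matrix (Fin d) (Fin e) F) :
    ((dualProj T *ᵥ u) z : ℂ) = (Fintype.card (Matrix (Fin d) (Fin e) F) : ℂ)⁻¹ *
      ∑ B ∈ T, matChar B z * matFourier u B := by
  rw [mulVec, dotProduct]
  push_cast
  simp only [dualProj_apply hT, matFourier, Finset.mul_sum, Finset.sum_mul]
  rw [Finset.sum_comm]
  refine Finset.sum_congr rfl fun B _ => Finset.sum_congr rfl fun w _ => ?_
  rw [sub_eq_add_neg, AddChar.map_add_eq_mul]
  ring

omit [DecidableEq F] in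
theorem dualProj_mulVec_congr {T : Finset (Matrix (Fin d) (Fin e) F)} (hT : ∀ B ∈ T, -B ∈ T)
    {u v : Matrix (Fin d) (Fin e) F → ℝ} (h : ∀ B ∈ T, matFourier u B = matFourier v B) :
    dualProj T *ᵥ u = dualProj T *ᵥ v := by
  funext z
  rw [← Complex.ofReal_inj, dualProj_mulVec_apply hT, dualProj_mulVec_apply hT]
  congr 1
  exact Finset.sum_congr rfl fun B hB => by rw [h B hB]

/-- The Fourier transform of a product of two vectors in the image of the projection. -/
theorem matFourier_mul_dualProj {T : Finset (Matrix (Fin d) (Fin e) F)} (hT : ∀ B ∈ T, -B ∈ T)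
    (u v : Matrix (Fin d) (Fin e) F → ℝ) (B : Matrix (Fin d) (Fin e) F) :
    matFourier ((dualProj T *ᵥ u) * (dualProj T *ᵥ v)) B =
      (Fintype.card (Matrix (Fin d) (Fin e) F) : ℂ)⁻¹ *
        ∑ Q ∈ T with B - Q ∈ T, matFourier u (B - Q) * matFourier v Q := by
  set n : ℂ := (Fintype.card (Matrix (Fin d) (Fin e) F) : ℂ) with hn
  have hn0 : n ≠ 0 := by
    rw [hn]; exact_mod_cast Fintype.card_ne_zero
  have h1 : ∀ z, matChar B (-z) * (((dualProj T *ᵥ u) * (dualProj T *ᵥ v)) z : ℂ) =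
      ∑ Q ∈ T, ∑ P ∈ T, (n⁻¹ * n⁻¹ * matFourier u P * matFourier v Q) *
        matChar (P - (B - Q)) z := by
    intro z
    rw [Pi.mul_apply, Complex.ofReal_mul, dualProj_mulVec_apply hT, dualProj_mulVec_apply hT,
      ← hn, mul_mul_mul_comm, Finset.sum_mul_sum, Finset.sum_comm, Finset.mul_sum, Finset.mul_sum]
    refine Finset.sum_congr rfl fun Q _ => ?_
    rw [Finset.mul_sum, Finset.mul_sum]
    refine Finset.sum_congr rfl fun P _ => ?_
    rw [show P - (B - Q) = P + Q + -B by abel, matChar_add_left, matChar_add_left,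
      matChar_neg_left]
    ring
  rw [matFourier, Finset.sum_congr rfl fun z _ => h1 z, Finset.sum_comm, Finset.sum_filter,
    Finset.mul_sum]
  refine Finset.sum_congr rfl fun Q _ => ?_
  rw [Finset.sum_comm]
  simp only [← Finset.mul_sum, sum_matChar, sub_eq_zero (b := B - Q), mul_ite, mul_zero]
  rw [Finset.sum_ite_eq']
  split_ifs
  · rw [← hn]
    field_simp
  · rfl

/-- This is the self-duality behind the product formula. With B = a bᵀ and w = u vᵀ, both sides
reduce to an expression in whether a·u and b·v vanish and in the characters of multiples of
(a·u)(b·v), all symmetric under exchange of the two matrices. -/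
theorem sum_matChar_neighbors_comm {B w : Matrix (Fin d) (Fin e) F} (hB : B.rank = 1)
    (hw : w.rank = 1) :
    ∑ Q ∈ rankOnes F d e with (Q - B).rank = 1, matChar Q (-w) =
      ∑ m ∈ rankOnes F d e with (m - w).rank = 1, matChar m (-B) := by
  obtain ⟨a, b, ha, hb, rfl⟩ := exists_vecMulVec_of_rank_eq_one hB
  obtain ⟨u, v, hu, hv, rfl⟩ := exists_vecMulVec_of_rank_eq_one hw
  rw [sum_neighbors_rankOnes _ ha hb, sum_neighbors_rankOnes _ hu hv]
  have hrow : ∀ (a u : Fin d → F) {v : Fin e → F}, v ≠ 0 →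
      ∑ b ∈ Finset.univ.erase 0, matChar (vecMulVec a b) (-vecMulVec u v) =
        (if a ⬝ᵥ u = 0 then (Fintype.card F : ℂ) ^ e else 0) - 1 := by
    intro a u v hv
    have h := sum_erase_fieldChar_dotProduct ((-(a ⬝ᵥ u)) • v)
    simp only [smul_eq_zero, hv, or_false, neg_eq_zero] at h
    rw [← h]
    refine Finset.sum_congr rfl fun b _ => ?_
    rw [← neg_vecMulVec, matChar_vecMulVec_vecMulVec, dotProduct_neg, smul_dotProduct, smul_eq_mul,
      dotProduct_comm b]
  have hcol : ∀ {u : Fin d → F} (b v : Fin e → F), u ≠ 0 →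
      ∑ a ∈ Finset.univ.erase 0, matChar (vecMulVec a b) (-vecMulVec u v) =
        (if b ⬝ᵥ v = 0 then (Fintype.card F : ℂ) ^ d else 0) - 1 := by
    intro u b v hu
    have h := sum_erase_fieldChar_dotProduct ((-(b ⬝ᵥ v)) • u)
    simp only [smul_eq_zero, hu, or_false, neg_eq_zero] at h
    rw [← h]
    refine Finset.sum_congr rfl fun a _ => ?_
    rw [← neg_vecMulVec, matChar_vecMulVec_vecMulVec, dotProduct_neg, smul_dotProduct, smul_eq_mul,
      dotProduct_comm a, neg_mul, neg_mul, mul_comm]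
  rw [hrow a u hv, hrow u a hb, hcol b v hu, hcol v b ha, dotProduct_comm a u, dotProduct_comm b v]
  congr 1
  · congr 1
    refine Finset.sum_congr rfl fun c _ => ?_
    rw [matChar_comm, matChar_neg_left, ← smul_neg, matChar_apply, matChar_apply, transpose_smul,
      Matrix.mul_smul, Matrix.smul_mul]
  · rw [matChar_comm, matChar_neg_left]

omit [DecidableEq F] in
theorem mem_distSphere {i : ℕ} {x y : Matrix (Fin d) (Fin e) F} :
    y ∈ distSphere (bilinearFormsGraph F d e) i x ↔ (x - y).rank = i := by
  simp [distSphere, bilinearFormsGraph_dist]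

/-- By the convolution formula the left side has coefficient |X|⁻¹ χ_B(-x) ∑ χ_Q(-(z - x)) over Q
adjacent to B. Exchanging B with z - x turns this into a sum over m adjacent to z - x, and x + m
runs over the common neighbours. -/
theorem norton_single_single {x z : Matrix (Fin d) (Fin e) F} (hz : (z - x).rank = 1) :
    dualProj (rankOnes F d e) *ᵥ
        ((dualProj (rankOnes F d e) *ᵥ Pi.single x 1) *
          (dualProj (rankOnes F d e) *ᵥ Pi.single z 1)) =
      dualProj (rankOnes F d e) *ᵥ ((Fintype.card (Matrix (Fin d) (Fin e) F) : ℝ)⁻¹ •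
        charVec (distSphere (bilinearFormsGraph F d e) 1 x ∩
          distSphere (bilinearFormsGraph F d e) 1 z)) := by
  refine dualProj_mulVec_congr neg_mem_rankOnes fun B hB => ?_
  rw [matFourier_mul_dualProj neg_mem_rankOnes, matFourier_smul, matFourier_charVec]
  push_cast
  congr 1
  have h := congrArg (matChar B (-x) * ·) (sum_matChar_neighbors_comm (mem_rankOnes.1 hB) hz)
  simp only [Finset.mul_sum] at h
  refine Eq.trans ?_ (h.trans ?_)
  · refine Finset.sum_congr ?_ fun Q _ => ?_
    · ext Q
      rw [Finset.mem_filter, Finset.mem_filter, mem_rankOnes, mem_rankOnes, rank_sub_comm B]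
    · rw [matFourier_single, matFourier_single, sub_eq_add_neg, matChar_add_left, matChar_neg_left,
        mul_assoc, ← AddChar.map_add_eq_mul]
      congr 2
      abel
  · refine Finset.sum_nbij' (fun m => x + m) (fun w => w - x) ?_ ?_ (by simp) (by simp) ?_
    · intro m hm
      rw [Finset.mem_filter, mem_rankOnes] at hm
      rw [Finset.mem_inter, mem_distSphere, mem_distSphere, sub_add_cancel_left, rank_neg_matrix,
        rank_sub_comm, show x + m - z = m - (z - x) by abel]
      exact hm
    · intro w hw
      rw [Finset.mem_inter, mem_distSphere, mem_distSphere] at hw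
      rw [Finset.mem_filter, mem_rankOnes, sub_sub_sub_cancel_right, rank_sub_comm w,
        rank_sub_comm w]
      exact hw
    · intro m _
      rw [matChar_comm m, matChar_neg_left, ← AddChar.map_add_eq_mul, neg_add]

end Fourier

/-! ### The six classes of rank one matrices relative to `M`, and the neighbour counts between them.
-/

section Classes

variable {F : Type*} [Field F] [Fintype F] [DecidableEq F] {d e : ℕ}

open Matrix Module

/-- The class of the rank one matrix `u vᵀ` with respect to a matrix `M` with generalized
inverse `G`. -/
def pairClass (M : Matrix (Fin d) (Fin e) F) (G : Matrix (Fin e) (Fin d) F) (u : Fin d → F)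
    (v : Fin e → F) : Fin 6 :=
  if InCol M G u then
    if InRow M G v then
      if v ⬝ᵥ (G *ᵥ u) = 1 then 0 else if v ⬝ᵥ (G *ᵥ u) = 0 then 1 else 2
    else 3
  else if InRow M G v then 4 else 5

/-- The class of a rank one matrix with respect to a matrix `M` with generalized inverse `G`,
according to whether its column and row spaces lie in those of `M`. -/
def matClass (M : Matrix (Fin d) (Fin e) F) (G : Matrix (Fin e) (Fin d) F)
    (z : Matrix (Fin d) (Fin e) F) : Fin 6 :=
  if M * G * z = z then
    if z * G * M = z then
      if (G * z).trace = 1 then 0 else if (G * z).trace = 0 then 1 else 2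
    else 3
  else if z * G * M = z then 4 else 5

omit [Fintype F] in
-- The class is defined from the matrix alone, so it does not depend on the factorisation; this
-- gives its form in terms of the factors.
theorem matClass_vecMulVec {M : Matrix (Fin d) (Fin e) F} {G : Matrix (Fin e) (Fin d) F}
    {u : Fin d → F} {v : Fin e → F} (hu : u ≠ 0) (hv : v ≠ 0) :
    matClass M G (vecMulVec u v) = pairClass M G u v := by
  have h1 : M * G * vecMulVec u v = vecMulVec u v ↔ InCol M G u := by
    rw [mul_vecMulVec, ← mulVec_mulVec, InCol]
    refine ⟨fun h => ?_, fun h => by rw [h]⟩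
    obtain ⟨j, hj⟩ := Function.ne_iff.1 hv
    funext i
    exact mul_right_cancel₀ hj (congrFun (congrFun h i) j)
  have h2 : vecMulVec u v * G * M = vecMulVec u v ↔ InRow M G v := by
    rw [vecMulVec_mul, vecMulVec_mul, InRow]
    refine ⟨fun h => ?_, fun h => by rw [h]⟩
    obtain ⟨i, hi⟩ := Function.ne_iff.1 hu
    funext j
    exact mul_left_cancel₀ hi (congrFun (congrFun h i) j)
  have h3 : (G * vecMulVec u v).trace = v ⬝ᵥ (G *ᵥ u) := by
    rw [mul_vecMulVec, trace_vecMulVec, dotProduct_comm]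
  simp only [matClass, pairClass, h1, h2, h3]

omit [Fintype F] in
theorem pairClass_transpose (M : Matrix (Fin d) (Fin e) F) (G : Matrix (Fin e) (Fin d) F)
    (u : Fin d → F) (v : Fin e → F) :
    pairClass Mᵀ Gᵀ v u = Equiv.swap 3 4 (pairClass M G u v) := by
  have h1 : InCol Mᵀ Gᵀ v ↔ InRow M G v := inRow_iff_inCol_transpose.symm
  have h2 : InRow Mᵀ Gᵀ u ↔ InCol M G u := by
    rw [inRow_iff_inCol_transpose, transpose_transpose, transpose_transpose]
  have h3 : u ⬝ᵥ (Gᵀ *ᵥ v) = v ⬝ᵥ (G *ᵥ u) := by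
    rw [mulVec_transpose, dotProduct_comm, dotProduct_mulVec]
  simp only [pairClass, h1, h2, h3]
  split_ifs <;> decide

omit [Fintype F] [DecidableEq F] in
theorem inRow_iff_mem_range {M : Matrix (Fin d) (Fin e) F} {G : Matrix (Fin e) (Fin d) F}
    (hG : M * G * M = M) {v : Fin e → F} :
    InRow M G v ↔ v ∈ LinearMap.range Mᵀ.mulVecLin := by
  constructor
  · intro h
    exact ⟨v ᵥ* G, by rw [mulVecLin_apply, mulVec_transpose, h.eq]⟩
  · rintro ⟨r, rfl⟩
    rw [mulVecLin_apply, mulVec_transpose]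
    exact inRow_vecMul hG r

omit [Fintype F] [DecidableEq F] in
theorem inCol_iff_mem_range {M : Matrix (Fin d) (Fin e) F} {G : Matrix (Fin e) (Fin d) F}
    (hG : M * G * M = M) {u : Fin d → F} :
    InCol M G u ↔ u ∈ LinearMap.range M.mulVecLin := by
  constructor
  · intro h
    exact ⟨G *ᵥ u, h⟩
  · rintro ⟨p, rfl⟩
    exact inCol_mulVec hG p

theorem card_filter_inRow {M : Matrix (Fin d) (Fin e) F} {G : Matrix (Fin e) (Fin d) F}
    (hG : M * G * M = M) :
    (Finset.univ.filter fun v : Fin e → F => InRow M G v).card = Fintype.card F ^ M.rank := by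
  rw [← Fintype.card_subtype, ← rank_transpose M, ← Nat.card_eq_fintype_card,
    ← Nat.card_eq_fintype_card, Matrix.rank, ← Module.natCard_eq_pow_finrank]
  exact Nat.card_congr (Equiv.subtypeEquivRight fun v => inRow_iff_mem_range hG)

theorem card_filter_inCol {M : Matrix (Fin d) (Fin e) F} {G : Matrix (Fin e) (Fin d) F}
    (hG : M * G * M = M) :
    (Finset.univ.filter fun u : Fin d → F => InCol M G u).card = Fintype.card F ^ M.rank := by
  have h := card_filter_inRow (generalized_inverse_transpose hG)
  rw [rank_transpose] at h
  simpa only [inRow_iff_inCol_transpose, transpose_transpose] using h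

theorem card_mul_card_fiber {V : Type*} [AddCommGroup V] [Module F V] [Fintype V]
    {f : V →ₗ[F] F} (hf : f ≠ 0) (c : F) :
    Fintype.card F * (Finset.univ.filter fun v => f v = c).card = Fintype.card V := by
  have hs : Function.Surjective f := LinearMap.surjective hf
  rw [← Finset.card_univ, ← Finset.card_univ, ← smul_eq_mul, ← Finset.sum_const,
    Finset.card_eq_sum_card_fiberwise (s := (Finset.univ : Finset V)) (f := f) (t := Finset.univ)
      (by simp)]
  exact Finset.sum_congr rfl fun c' _ =>
    AddMonoidHom.card_fiber_eq_of_mem_range f.toAddMonoidHom (hs c) (hs c')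

omit [Fintype F] [DecidableEq F] in
theorem rank_pos_of_inCol {M : Matrix (Fin d) (Fin e) F} {G : Matrix (Fin e) (Fin d) F}
    {u : Fin d → F} (hu : u ≠ 0) (h : InCol M G u) : 0 < M.rank := by
  rw [Nat.pos_iff_ne_zero]
  intro h0
  rw [matrix_rank_eq_zero] at h0
  rw [InCol, h0, zero_mulVec] at h
  exact hu h.symm

/-- On the row space of `M` the functional v ↦ vᵀGu is nonzero, because it sends rᵀM to r·u; all its
fibres therefore have the same size. -/
theorem card_filter_pairing {M : Matrix (Fin d) (Fin e) F} {G : Matrix (Fin e) (Fin d) F}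
    (hG : M * G * M = M) {u : Fin d → F} (hu : u ≠ 0) (h : InCol M G u) (c : F) :
    (Finset.univ.filter fun v : Fin e → F => InRow M G v ∧ v ⬝ᵥ (G *ᵥ u) = c).card =
      Fintype.card F ^ (M.rank - 1) := by
  have hk := rank_pos_of_inCol hu h
  let f : LinearMap.range Mᵀ.mulVecLin →ₗ[F] F :=
    (dotProductBilin F F (G *ᵥ u)).domRestrict (LinearMap.range Mᵀ.mulVecLin)
  have hf : f ≠ 0 := by
    intro h0
    apply hu
    apply dotProduct_eq_zero u
    intro r
    have := LinearMap.congr_fun h0 ⟨_, r, rfl⟩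
    simp only [f, LinearMap.domRestrict_apply, dotProductBilin_apply_apply, mulVecLin_apply,
      mulVec_transpose, LinearMap.zero_apply] at this
    rwa [dotProduct_comm, ← dotProduct_mulVec, h.eq, dotProduct_comm] at this
  have h1 := card_mul_card_fiber hf c
  have h2 : Fintype.card (LinearMap.range Mᵀ.mulVecLin) = Fintype.card F ^ M.rank := by
    rw [← rank_transpose M, ← Nat.card_eq_fintype_card, ← Nat.card_eq_fintype_card, Matrix.rank,
      ← Module.natCard_eq_pow_finrank]
  obtain ⟨k, hk'⟩ : ∃ k, M.rank = k + 1 := ⟨M.rank - 1, by lia⟩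
  rw [h2, hk', pow_succ, mul_comm] at h1
  rw [hk', Nat.add_sub_cancel]
  rw [← Nat.eq_of_mul_eq_mul_right Fintype.card_pos h1]
  symm
  refine Finset.card_bij (fun v _ => v.1) ?_ ?_ ?_
  · intro v hv
    simp only [Finset.mem_filter, Finset.mem_univ, true_and] at hv ⊢
    exact ⟨(inRow_iff_mem_range hG).2 v.2, by rw [← hv, dotProduct_comm]; rfl⟩
  · intro v _ w _ hvw
    exact Subtype.ext hvw
  · intro v hv
    simp only [Finset.mem_filter, Finset.mem_univ, true_and] at hv
    refine ⟨⟨v, (inRow_iff_mem_range hG).1 hv.1⟩, ?_, rfl⟩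
    simp only [Finset.mem_filter, Finset.mem_univ, true_and]
    exact (dotProduct_comm _ _).trans hv.2

/-- The number of nonzero `v : F^n` such that `u vᵀ` has class `j`, where `b` says whether `u` lies
in the column space. -/
def lineCount (q k n : ℕ) (b : Prop) [Decidable b] (j : Fin 6) : ℤ :=
  if b then
    ![(q : ℤ) ^ (k - 1), (q : ℤ) ^ (k - 1) - 1, (q : ℤ) ^ k - 2 * (q : ℤ) ^ (k - 1),
      (q : ℤ) ^ n - (q : ℤ) ^ k, 0, 0] j
  else ![0, 0, 0, 0, (q : ℤ) ^ k - 1, (q : ℤ) ^ n - (q : ℤ) ^ k] j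

theorem sum_inRow {M : Matrix (Fin d) (Fin e) F} {G : Matrix (Fin e) (Fin d) F}
    (hG : M * G * M = M) :
    ∑ v : Fin e → F, (if InRow M G v then 1 else 0 : ℤ) = (Fintype.card F : ℤ) ^ M.rank := by
  rw [Finset.sum_boole, card_filter_inRow hG, Nat.cast_pow]

theorem sum_not_inRow {M : Matrix (Fin d) (Fin e) F} {G : Matrix (Fin e) (Fin d) F}
    (hG : M * G * M = M) :
    ∑ v : Fin e → F, (if InRow M G v then 0 else 1 : ℤ) =
      (Fintype.card F : ℤ) ^ e - (Fintype.card F : ℤ) ^ M.rank := by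
  have hall : ∑ v : Fin e → F, (1 : ℤ) = (Fintype.card F : ℤ) ^ e := by simp
  rw [← sum_inRow hG, ← hall, ← Finset.sum_sub_distrib]
  exact Finset.sum_congr rfl fun v _ => by by_cases hr : InRow M G v <;> simp [hr]

/-- Classes 0 and 1 are fibres of the pairing on the row space, class 2 is the rest of the row space
and class 3 its complement. The excluded v = 0 would have class 1, whence the `- 1` in that count
only. -/
theorem sum_pairClass_of_inCol {M : Matrix (Fin d) (Fin e) F} {G : Matrix (Fin e) (Fin d) F}
    (hG : M * G * M = M) {u : Fin d → F} (hu : u ≠ 0) (h : InCol M G u) (j : Fin 6) :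
    ∑ v ∈ Finset.univ.erase 0, (if pairClass M G u v = j then 1 else 0 : ℤ) =
      lineCount (Fintype.card F) M.rank e (InCol M G u) j := by
  have h0row : InRow M G (0 : Fin e → F) := by rw [InRow, zero_vecMul, zero_vecMul]
  have hp : ∀ c, ∑ v : Fin e → F, (if InRow M G v ∧ v ⬝ᵥ (G *ᵥ u) = c then 1 else 0 : ℤ) =
      (Fintype.card F : ℤ) ^ (M.rank - 1) := fun c => by
    rw [Finset.sum_boole, card_filter_pairing hG hu h c, Nat.cast_pow]
  have h0 : pairClass M G u 0 = 1 := by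
    simp only [pairClass, if_pos h, if_pos h0row, zero_dotProduct, zero_ne_one, if_false, if_true]
  rw [Finset.sum_erase_eq_sub (Finset.mem_univ _), h0, lineCount, if_pos h]
  have hf : ∀ g : (Fin e → F) → ℤ, (∀ v, (if pairClass M G u v = j then 1 else 0 : ℤ) = g v) →
      ∑ v, (if pairClass M G u v = j then 1 else 0 : ℤ) = ∑ v, g v :=
    fun g hg => Finset.sum_congr rfl fun v _ => hg v
  fin_cases j <;> simp only [Fin.reduceFinMk, Fin.zero_eta, Fin.mk_one, cons_val] at hf ⊢
  · rw [hf (fun v => if InRow M G v ∧ v ⬝ᵥ (G *ᵥ u) = 1 then 1 else 0), hp]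
    · simp
    · intro v
      by_cases hr : InRow M G v <;> by_cases h1 : v ⬝ᵥ (G *ᵥ u) = 1 <;>
        by_cases h0 : v ⬝ᵥ (G *ᵥ u) = 0 <;> simp [pairClass, h, hr, h1, h0]
  · rw [hf (fun v => if InRow M G v ∧ v ⬝ᵥ (G *ᵥ u) = 0 then 1 else 0), hp]
    · simp
    · intro v
      by_cases hr : InRow M G v <;> by_cases h1 : v ⬝ᵥ (G *ᵥ u) = 1 <;>
        by_cases h0 : v ⬝ᵥ (G *ᵥ u) = 0 <;> simp [pairClass, h, hr, h1, h0]
  · rw [hf (fun v => (if InRow M G v then 1 else 0) -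
      (if InRow M G v ∧ v ⬝ᵥ (G *ᵥ u) = 1 then 1 else 0) -
      (if InRow M G v ∧ v ⬝ᵥ (G *ᵥ u) = 0 then 1 else 0)), Finset.sum_sub_distrib,
      Finset.sum_sub_distrib, hp, hp, sum_inRow hG, if_neg (by decide)]
    · ring
    · intro v
      by_cases hr : InRow M G v <;> by_cases h1 : v ⬝ᵥ (G *ᵥ u) = 1 <;>
        by_cases h0 : v ⬝ᵥ (G *ᵥ u) = 0 <;> simp [pairClass, h, hr, h1, h0]
  · rw [hf (fun v => if InRow M G v then 0 else 1), sum_not_inRow hG, if_neg (by decide), sub_zero]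
    intro v
    by_cases hr : InRow M G v <;> by_cases h1 : v ⬝ᵥ (G *ᵥ u) = 1 <;>
      by_cases h0 : v ⬝ᵥ (G *ᵥ u) = 0 <;> simp [pairClass, h, hr, h1, h0]
  iterate 2
    · rw [hf (fun v => 0), Finset.sum_const_zero, if_neg (by decide), sub_zero]
      intro v
      by_cases hr : InRow M G v <;> by_cases h1 : v ⬝ᵥ (G *ᵥ u) = 1 <;>
        by_cases h0 : v ⬝ᵥ (G *ᵥ u) = 0 <;> simp [pairClass, h, hr, h1, h0]

theorem sum_pairClass {M : Matrix (Fin d) (Fin e) F} {G : Matrix (Fin e) (Fin d) F}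
    (hG : M * G * M = M) {u : Fin d → F} (hu : u ≠ 0) (j : Fin 6) :
    ∑ v ∈ Finset.univ.erase 0, (if pairClass M G u v = j then 1 else 0 : ℤ) =
      lineCount (Fintype.card F) M.rank e (InCol M G u) j := by
  by_cases h : InCol M G u
  · exact sum_pairClass_of_inCol hG hu h j
  have h0row : InRow M G (0 : Fin e → F) := by rw [InRow, zero_vecMul, zero_vecMul]
  have hinj : ∀ v, pairClass M G u v = if InRow M G v then 4 else 5 := fun v => by
    rw [pairClass, if_neg h]
  rw [Finset.sum_erase_eq_sub (Finset.mem_univ _), lineCount, if_neg h]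
  simp only [hinj, if_pos h0row]
  have hite : ∀ v, (if (if InRow M G v then 4 else 5) = j then 1 else 0 : ℤ) =
      (if InRow M G v then 1 else 0) * (if 4 = j then 1 else 0) +
      (if InRow M G v then 0 else 1) * (if 5 = j then 1 else 0) := by
    intro v
    by_cases hr : InRow M G v <;> simp [hr]
  simp only [hite]
  rw [Finset.sum_add_distrib, ← Finset.sum_mul, ← Finset.sum_mul, sum_inRow hG, sum_not_inRow hG]
  fin_cases j <;> simp

theorem sum_pairClass_left {M : Matrix (Fin d) (Fin e) F} {G : Matrix (Fin e) (Fin d) F}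
    (hG : M * G * M = M) {v : Fin e → F} (hv : v ≠ 0) (j : Fin 6) :
    ∑ u ∈ Finset.univ.erase 0, (if pairClass M G u v = j then 1 else 0 : ℤ) =
      lineCount (Fintype.card F) M.rank d (InRow M G v) (Equiv.swap 3 4 j) := by
  have h := sum_pairClass (generalized_inverse_transpose hG) hv (Equiv.swap 3 4 j)
  simp only [pairClass_transpose, (Equiv.swap (3 : Fin 6) 4).injective.eq_iff, rank_transpose,
    ← inRow_iff_inCol_transpose] at h
  exact h

/-- The number of nonzero multiples of class `j` of a rank one matrix of class `i`. -/
def scalarCount (q : ℕ) (i j : Fin 6) : ℤ :=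
  if i = 0 ∨ i = 2 then ![1, 0, (q : ℤ) - 2, 0, 0, 0] j else if i = j then (q : ℤ) - 1 else 0

/-- Scaling by c ≠ 0 preserves the column and row conditions and multiplies the pairing by c. A
nonzero pairing becomes 1 for exactly one c, so classes 0 and 2 mix and the others are stable. -/
theorem sum_matClass_smul (M : Matrix (Fin d) (Fin e) F) (G : Matrix (Fin e) (Fin d) F)
    (z : Matrix (Fin d) (Fin e) F) (j : Fin 6) :
    ∑ c ∈ Finset.univ.erase (0 : F), (if matClass M G (c • z) = j then 1 else 0 : ℤ) =
      scalarCount (Fintype.card F) (matClass M G z) j := by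
  have hq : 1 ≤ Fintype.card F := Fintype.card_pos
  have hinv : ∀ c ∈ Finset.univ.erase (0 : F), matClass M G (c • z) =
      if M * G * z = z then if z * G * M = z then
        if c * (G * z).trace = 1 then 0 else if (G * z).trace = 0 then 1 else 2 else 3
      else if z * G * M = z then 4 else 5 := by
    intro c hc
    have hc0 : c ≠ 0 := Finset.ne_of_mem_erase hc
    have h1 : M * G * (c • z) = c • z ↔ M * G * z = z := by
      rw [Matrix.mul_smul]
      exact (smul_right_injective _ hc0).eq_iff
    have h2 : (c • z) * G * M = c • z ↔ z * G * M = z := by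
      rw [Matrix.smul_mul, Matrix.smul_mul]
      exact (smul_right_injective _ hc0).eq_iff
    have h3 : (G * (c • z)).trace = c * (G * z).trace := by
      rw [Matrix.mul_smul, trace_smul, smul_eq_mul]
    have h4 : c * (G * z).trace = 0 ↔ (G * z).trace = 0 := by simp [hc0]
    simp only [matClass, h1, h2, h3, h4]
  rw [Finset.sum_congr rfl fun c hc => by rw [hinv c hc], matClass]
  have hconst : ∀ i : Fin 6, i ≠ 0 ∧ i ≠ 2 →
      ∑ c ∈ Finset.univ.erase (0 : F), (if i = j then 1 else 0 : ℤ) =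
        scalarCount (Fintype.card F) i j := by
    intro i hi
    rw [scalarCount, if_neg (c := i = 0 ∨ i = 2) (by tauto), Finset.sum_const,
      Finset.card_erase_of_mem (Finset.mem_univ _), Finset.card_univ, nsmul_eq_mul,
      Nat.cast_sub hq]
    simp
  by_cases h1 : M * G * z = z
  · simp only [if_pos h1]
    by_cases h2 : z * G * M = z
    · simp only [if_pos h2]
      by_cases ht : (G * z).trace = 0
      · simp only [ht, mul_zero, zero_ne_one, if_false, if_true]
        exact hconst 1 (by decide)
      · have hi : (if (G * z).trace = 1 then 0 else if (G * z).trace = 0 then 1 else 2 : Fin 6) = 0 ∨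
            (if (G * z).trace = 1 then 0 else if (G * z).trace = 0 then 1 else 2 : Fin 6) = 2 := by
          rw [if_neg ht]
          split_ifs <;> simp
        rw [scalarCount, if_pos hi]
        simp only [if_neg ht, mul_eq_one_iff_eq_inv₀ ht]
        have hite : ∀ c : F, (if (if c = (G * z).trace⁻¹ then 0 else 2) = j then 1 else 0 : ℤ) =
            (if c = (G * z).trace⁻¹ then (if 0 = j then 1 else 0) - (if 2 = j then 1 else 0) else 0)
              + (if 2 = j then 1 else 0) := by
          intro c
          by_cases hc : c = (G * z).trace⁻¹ <;> simp [hc]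
        simp only [hite]
        rw [Finset.sum_add_distrib, Finset.sum_ite_eq', if_pos (by simp [ht]), Finset.sum_const,
          Finset.card_erase_of_mem (Finset.mem_univ _), Finset.card_univ, nsmul_eq_mul,
          Nat.cast_sub hq]
        fin_cases j <;> simp
        ring
    · simp only [if_neg h2]
      exact hconst 3 (by decide)
  · simp only [if_neg h1]
    by_cases h2 : z * G * M = z
    · simp only [if_pos h2]
      exact hconst 4 (by decide)
    · simp only [if_neg h2]
      exact hconst 5 (by decide)

/-- The number of rank one matrices of class `j` adjacent to a rank one matrix of class `i`. -/
def neighborCount (q k d e : ℕ) (i j : Fin 6) : ℤ :=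
  lineCount q k e (i = 0 ∨ i = 1 ∨ i = 2 ∨ i = 3) j +
    lineCount q k d (i = 0 ∨ i = 1 ∨ i = 2 ∨ i = 4) (Equiv.swap 3 4 j) -
    scalarCount q i j - if i = j then 1 else 0

theorem lineCount_congr {q k n : ℕ} {b b' : Prop} [Decidable b] [Decidable b'] (h : b ↔ b')
    (j : Fin 6) : lineCount q k n b j = lineCount q k n b' j := by
  simp only [lineCount, h]

omit [Fintype F] in
theorem inCol_iff_pairClass {M : Matrix (Fin d) (Fin e) F} {G : Matrix (Fin e) (Fin d) F}
    {u : Fin d → F} {v : Fin e → F} : InCol M G u ↔ pairClass M G u v = 0 ∨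
      pairClass M G u v = 1 ∨ pairClass M G u v = 2 ∨ pairClass M G u v = 3 := by
  rw [pairClass]
  split_ifs with h <;> simp [h]

omit [Fintype F] in
theorem inRow_iff_pairClass {M : Matrix (Fin d) (Fin e) F} {G : Matrix (Fin e) (Fin d) F}
    {u : Fin d → F} {v : Fin e → F} : InRow M G v ↔ pairClass M G u v = 0 ∨
      pairClass M G u v = 1 ∨ pairClass M G u v = 2 ∨ pairClass M G u v = 4 := by
  rw [pairClass]
  split_ifs with _ h _ _ h <;> simp [h]

/-- The source of equitability: on the matrices sharing the factor u the class distribution depends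
only on whether u is in the column space, similarly for v, and both facts are determined by the
class of z. -/
theorem card_neighbors_matClass {M : Matrix (Fin d) (Fin e) F} {G : Matrix (Fin e) (Fin d) F}
    (hG : M * G * M = M) {z : Matrix (Fin d) (Fin e) F} (hz : z.rank = 1) (j : Fin 6) :
    ((Finset.univ.filter fun w : Matrix (Fin d) (Fin e) F =>
      w.rank = 1 ∧ (w - z).rank = 1 ∧ matClass M G w = j).card : ℤ) =
        neighborCount (Fintype.card F) M.rank d e (matClass M G z) j := by
  obtain ⟨u, v, hu, hv, rfl⟩ := exists_vecMulVec_of_rank_eq_one hz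
  have h := sum_neighbors_rankOnes (fun w => if matClass M G w = j then 1 else 0 : _ → ℤ) hu hv
  rw [sum_matClass_smul, Finset.sum_congr (s₁ := Finset.univ.erase (0 : Fin e → F)) rfl fun v' hv' => by
      rw [matClass_vecMulVec hu (Finset.ne_of_mem_erase hv')],
    Finset.sum_congr (s₁ := Finset.univ.erase (0 : Fin d → F)) rfl fun u' hu' => by
      rw [matClass_vecMulVec (Finset.ne_of_mem_erase hu') hv],
    sum_pairClass hG hu, sum_pairClass_left hG hv, matClass_vecMulVec hu hv,
    lineCount_congr (inCol_iff_pairClass (v := v)), lineCount_congr (inRow_iff_pairClass (u := u)),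
    Finset.sum_boole, Finset.filter_filter, rankOnes, Finset.filter_filter] at h
  rw [matClass_vecMulVec hu hv, neighborCount, ← h]

omit [Fintype F] in
theorem rank_sub_eq_of_matClass {M : Matrix (Fin d) (Fin e) F} {G : Matrix (Fin e) (Fin d) F}
    (hG : M * G * M = M) {z : Matrix (Fin d) (Fin e) F} (hz : z.rank = 1) :
    ((matClass M G z = 0 → (M - z).rank + 1 = M.rank) ∧
      (matClass M G z = 5 → (M - z).rank = M.rank + 1)) ∧
      (matClass M G z ≠ 0 → matClass M G z ≠ 5 → (M - z).rank = M.rank) := by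
  obtain ⟨u, v, hu, hv, rfl⟩ := exists_vecMulVec_of_rank_eq_one hz
  rw [matClass_vecMulVec hu hv, pairClass]
  split_ifs with h1 h2 h3 h4 h5
  · exact ⟨⟨fun _ => rank_sub_vecMulVec_of_pairing_eq_one h1 h2 h3, by simp⟩, by simp⟩
  · exact ⟨by simp, fun _ _ => rank_sub_vecMulVec_of_inCol_of_inRow h1 h2 h3⟩
  · exact ⟨by simp, fun _ _ => rank_sub_vecMulVec_of_inCol_of_inRow h1 h2 h3⟩
  · exact ⟨by simp, fun _ _ => rank_sub_vecMulVec_of_inCol_of_not_inRow hG h1 h2⟩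
  · exact ⟨by simp, fun _ _ => rank_sub_vecMulVec_of_not_inCol_of_inRow hG h1 h5⟩
  · exact ⟨⟨by simp, fun _ => rank_sub_vecMulVec_of_not_inCol_of_not_inRow hG h1 h5⟩, by simp⟩

omit [Fintype F] in
theorem rank_sub_eq_pred_iff {M : Matrix (Fin d) (Fin e) F} {G : Matrix (Fin e) (Fin d) F}
    (hG : M * G * M = M) (hM : 0 < M.rank) {z : Matrix (Fin d) (Fin e) F} (hz : z.rank = 1) :
    (M - z).rank = M.rank - 1 ↔ matClass M G z = 0 := by
  obtain ⟨⟨h1, h2⟩, h3⟩ := rank_sub_eq_of_matClass hG hz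
  refine ⟨fun h => ?_, fun h => by have := h1 h; lia⟩
  by_contra h0
  by_cases h5 : matClass M G z = 5
  · have := h2 h5; lia
  · have := h3 h0 h5; lia

omit [Fintype F] in
theorem rank_sub_eq_succ_iff {M : Matrix (Fin d) (Fin e) F} {G : Matrix (Fin e) (Fin d) F}
    (hG : M * G * M = M) {z : Matrix (Fin d) (Fin e) F} (hz : z.rank = 1) :
    (M - z).rank = M.rank + 1 ↔ matClass M G z = 5 := by
  obtain ⟨⟨h1, h2⟩, h3⟩ := rank_sub_eq_of_matClass hG hz
  refine ⟨fun h => ?_, h2⟩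
  by_contra h5
  by_cases h0 : matClass M G z = 0
  · have := h1 h0; lia
  · have := h3 h0 h5; lia

omit [Fintype F] in
theorem rank_sub_eq_self_iff {M : Matrix (Fin d) (Fin e) F} {G : Matrix (Fin e) (Fin d) F}
    (hG : M * G * M = M) {z : Matrix (Fin d) (Fin e) F} (hz : z.rank = 1) :
    (M - z).rank = M.rank ↔ matClass M G z ≠ 0 ∧ matClass M G z ≠ 5 := by
  obtain ⟨⟨h1, h2⟩, h3⟩ := rank_sub_eq_of_matClass hG hz
  refine ⟨fun h => ⟨fun h0 => ?_, fun h5 => ?_⟩, fun h => h3 h.1 h.2⟩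
  · have := h1 h0; lia
  · have := h2 h5; lia

end Classes

/-! ### Equitable partitions and characteristic vectors. -/

section EquitablePartition

open Matrix

variable {X : Type*} [Fintype X] [DecidableEq X]

omit [Fintype X] in
theorem charVec_apply (Ω : Finset X) (w : X) : charVec Ω w = if w ∈ Ω then 1 else 0 := by
  simp [charVec, Finset.sum_apply, Pi.single_apply]

/-- Double counting: at a vertex w of O_i the left side counts the neighbours of w in O_j. -/
theorem IsEquitablePartition.sum_charVec {G : SimpleGraph X} {T : Finset X} {n : ℕ}
    {O : Fin n → Finset X} {C : Matrix (Fin n) (Fin n) ℕ} (h : IsEquitablePartition G T O C)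
    (j : Fin n) :
    ∑ z ∈ O j, charVec (T ∩ distSphere G 1 z) = ∑ i, (C i j : ℝ) • charVec (O i) := by
  funext w
  simp only [Finset.sum_apply, Pi.smul_apply, charVec_apply, smul_eq_mul, Finset.mem_inter]
  by_cases hw : w ∈ T
  · obtain ⟨i, -, hi⟩ := Finset.mem_biUnion.1 (h.cover ▸ hw)
    rw [Finset.sum_eq_single i]
    · rw [if_pos hi, mul_one, ← h.count i j w hi]
      simp only [hw, true_and]
      rw [Finset.sum_boole]
      congr 2
      ext z
      simp only [distSphere, Finset.mem_filter, Finset.mem_inter, Finset.mem_univ, true_and]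
      rw [SimpleGraph.dist_comm, and_comm]
    · intro i' _ hi'
      rw [if_neg, mul_zero]
      exact fun h' => Finset.disjoint_left.1 (h.disjoint i' i hi') h' hi
    · simp
  · simp only [hw, false_and, if_false, Finset.sum_const_zero]
    symm
    refine Finset.sum_eq_zero fun i _ => ?_
    rw [if_neg, mul_zero]
    exact fun hi => hw (h.cover ▸ Finset.mem_biUnion.2 ⟨i, Finset.mem_univ i, hi⟩)

end EquitablePartition

/-! ### Identification of the y-partition with the classes, and its equitability. -/

section YPartition

open Matrix Module

variable {F : Type*} [Field F] [Fintype F] [DecidableEq F] {d e : ℕ}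

theorem card_distSphere_inter {x y z : Matrix (Fin d) (Fin e) F} {G : Matrix (Fin e) (Fin d) F}
    (hG : (y - x) * G * (y - x) = y - x) (hz : (z - x).rank = 1) {m : ℕ} {j : Fin 6}
    (hm : ∀ w : Matrix (Fin d) (Fin e) F, w.rank = 1 →
      ((y - x - w).rank = m ↔ matClass (y - x) G w = j)) :
    ((distSphere (bilinearFormsGraph F d e) 1 x ∩ distSphere (bilinearFormsGraph F d e) 1 z ∩
      distSphere (bilinearFormsGraph F d e) m y).card : ℤ) =
        neighborCount (Fintype.card F) (y - x).rank d e (matClass (y - x) G (z - x)) j := by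
  rw [← card_neighbors_matClass hG hz]
  congr 1
  refine Finset.card_nbij' (fun w => w - x) (fun w => w + x) ?_ ?_ (by intro; simp) (by intro; simp)
  · intro w hw
    simp only [Finset.coe_inter, Set.mem_inter_iff, Finset.mem_coe, mem_distSphere] at hw
    obtain ⟨⟨h1, h2⟩, h3⟩ := hw
    rw [rank_sub_comm] at h1 h2
    simp only [Finset.coe_filter, Finset.mem_univ, true_and, Set.mem_ofPred_eq,
      sub_sub_sub_cancel_right]
    refine ⟨h1, h2, (hm _ h1).1 ?_⟩
    rwa [sub_sub_sub_cancel_right]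
  · intro w hw
    simp only [Finset.coe_filter, Finset.mem_univ, true_and, Set.mem_ofPred_eq] at hw
    obtain ⟨h1, h2, h3⟩ := hw
    simp only [Finset.coe_inter, Set.mem_inter_iff, Finset.mem_coe, mem_distSphere]
    rw [rank_sub_comm x, rank_sub_comm z, add_sub_cancel_right]
    refine ⟨⟨h1, ?_⟩, ?_⟩
    · have : w + x - z = w - (z - x) := by abel
      rwa [this]
    · rw [← (hm _ h1).2 h3]
      congr 1
      abel

/-- The distance to `y` separates classes 0 and 5 from the rest, and α and β are neighbour counts
into those two classes. Their values on classes 1 to 4 are pairwise distinct and equal to the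
prescribed ones. -/
theorem yPartition_eq {x y : Matrix (Fin d) (Fin e) F} {G : Matrix (Fin e) (Fin d) F}
    (hG : (y - x) * G * (y - x) = y - x) (hM : 0 < (y - x).rank) (hM' : (y - x).rank < d)
    (hde : d < e) (i : Fin 6) :
    yPartition x y i = Finset.univ.filter fun z => (z - x).rank = 1 ∧
      matClass (y - x) G (z - x) = i := by
  have hk : (bilinearFormsGraph F d e).dist x y = (y - x).rank := by
    rw [bilinearFormsGraph_dist, rank_sub_comm]
  set k := (y - x).rank with hkdef
  set q := Fintype.card F with hq
  have hq1 : 1 < q := Fintype.one_lt_card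
  have hpred : ∀ z, z.rank = 1 → ((y - x - z).rank = k - 1 ↔ matClass (y - x) G z = 0) :=
    fun z hz => rank_sub_eq_pred_iff hG hM hz
  have hsucc : ∀ z, z.rank = 1 → ((y - x - z).rank = k + 1 ↔ matClass (y - x) G z = 5) :=
    fun z hz => rank_sub_eq_succ_iff hG hz
  have hself : ∀ z, z.rank = 1 →
      ((y - x - z).rank = k ↔ matClass (y - x) G z ≠ 0 ∧ matClass (y - x) G z ≠ 5) :=
    fun z hz => rank_sub_eq_self_iff hG hz
  -- These inequalities keep the natural number subtractions from truncating and separate the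
  -- values: β > 0 marks classes 3 and 4, and d < e tells these two apart.
  have hQ : 0 < q ^ (k - 1) := pow_pos (by lia) _
  have hkd : q ^ k < q ^ d := Nat.pow_lt_pow_right hq1 hM'
  have hkde : q ^ d < q ^ e := Nat.pow_lt_pow_right hq1 hde
  ext z
  rw [Finset.mem_filter]
  simp only [Finset.mem_univ, true_and]
  by_cases hz : (z - x).rank = 1
  swap
  · have hz' : z ∉ distSphere (bilinearFormsGraph F d e) 1 x := by
      rwa [mem_distSphere, rank_sub_comm]
    simp only [hz, false_and, iff_false]
    fin_cases i <;> simp [yPartition, hz']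
  have hz' : z ∈ distSphere (bilinearFormsGraph F d e) 1 x := by
    rwa [mem_distSphere, rank_sub_comm]
  have hα := card_distSphere_inter hG hz hpred
  have hβ := card_distSphere_inter hG hz hsucc
  have hz0 := hpred _ hz
  have hz5 := hsucc _ hz
  have hzs := hself _ hz
  rw [sub_sub_sub_cancel_right] at hz0 hz5 hzs
  simp only [hz, true_and]
  have hzy : ∀ m, z ∈ distSphere (bilinearFormsGraph F d e) m y ↔ (y - z).rank = m :=
    fun m => mem_distSphere
  rw [← hkdef, ← hq] at hα hβ
  simp only [yPartition, hk, ← hq]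
  generalize matClass (y - x) G (z - x) = c at *
  have key : ∀ α β : ℕ, (α : ℤ) = neighborCount q k d e c 0 → (β : ℤ) = neighborCount q k d e c 5 →
      ((c ≠ 0 ∧ c ≠ 5) ∧ α = 2 * q ^ (k - 1) ∧ β = 0 ↔ c = 1) ∧
      ((c ≠ 0 ∧ c ≠ 5) ∧ α = 2 * q ^ (k - 1) - 1 ∧ β = 0 ↔ c = 2) ∧
      ((c ≠ 0 ∧ c ≠ 5) ∧ α = q ^ (k - 1) ∧ β = q ^ d - q ^ k ↔ c = 3) ∧
      ((c ≠ 0 ∧ c ≠ 5) ∧ α = q ^ (k - 1) ∧ β = q ^ e - q ^ k ↔ c = 4) := by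
    clear hpred hsucc hself hα hβ hz0 hz5 hzs hG
    intro α β hα hβ
    generalize hQ' : q ^ (k - 1) = Q at *
    generalize hK' : q ^ k = K at *
    generalize hD' : q ^ d = D at *
    generalize hE' : q ^ e = E at *
    have hQz : (q : ℤ) ^ (k - 1) = Q := by rw [← hQ']; push_cast; rfl
    have hKz : (q : ℤ) ^ k = K := by rw [← hK']; push_cast; rfl
    have hDz : (q : ℤ) ^ d = D := by rw [← hD']; push_cast; rfl
    have hEz : (q : ℤ) ^ e = E := by rw [← hE']; push_cast; rfl
    have h30 : Equiv.swap (3 : Fin 6) 4 0 = 0 := by decide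
    have h35 : Equiv.swap (3 : Fin 6) 4 5 = 5 := by decide
    rw [neighborCount, lineCount, lineCount, scalarCount, h30, hQz, hKz, hDz, hEz] at hα
    rw [neighborCount, lineCount, lineCount, scalarCount, h35, hQz, hKz, hDz, hEz] at hβ
    clear hQ' hK' hD' hE' hQz hKz hDz hEz
    fin_cases c <;> simp at hα hβ ⊢ <;> lia
  obtain ⟨k1, k2, k3, k4⟩ := key _ _ hα hβ
  fin_cases i <;>
    simp only [Fin.reduceFinMk, Fin.zero_eta, Fin.mk_one, cons_val, Finset.mem_filter,
      Finset.mem_inter, hz', true_and, hzy, hz0, hz5, hzs]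
  · exact k1
  · exact k2
  · exact k3
  · exact k4

theorem exists_not_inCol {M : Matrix (Fin d) (Fin e) F} {G : Matrix (Fin e) (Fin d) F}
    (hG : M * G * M = M) (hM : M.rank < d) : ∃ u : Fin d → F, u ≠ 0 ∧ ¬ InCol M G u := by
  by_contra! h
  have h1 : (Finset.univ.filter fun u : Fin d → F => InCol M G u) = Finset.univ := by
    refine Finset.filter_true_of_mem fun u _ => ?_
    by_cases hu : u = 0
    · rw [hu, InCol, mulVec_zero, mulVec_zero]
    · exact h u hu
  have h2 := card_filter_inCol hG
  rw [h1, Finset.card_univ, Fintype.card_fun, Fintype.card_fin] at h2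
  exact (Nat.pow_lt_pow_right Fintype.one_lt_card hM).ne' h2

omit [Fintype F] [DecidableEq F] in
theorem exists_inCol {M : Matrix (Fin d) (Fin e) F} {G : Matrix (Fin e) (Fin d) F}
    (hG : M * G * M = M) (hM : 0 < M.rank) : ∃ u : Fin d → F, u ≠ 0 ∧ InCol M G u := by
  by_contra! h
  apply hM.ne'
  rw [matrix_rank_eq_zero]
  apply Matrix.mulVec_injective
  funext p
  rw [zero_mulVec]
  by_contra hp
  exact h _ hp (inCol_mulVec hG p)

/-- Classes 0 to 3 occur with u in the column space, classes 4 and 5 with u outside it. Class 1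
needs rank at least 2, and class 2 needs a scalar other than 0 and 1, hence q ≠ 2. -/
theorem exists_matClass_eq (hq : Fintype.card F ≠ 2) {M : Matrix (Fin d) (Fin e) F}
    {G : Matrix (Fin e) (Fin d) F} (hG : M * G * M = M) (hM : 2 ≤ M.rank) (hd : M.rank < d)
    (he : M.rank < e) (j : Fin 6) :
    ∃ z : Matrix (Fin d) (Fin e) F, z.rank = 1 ∧ matClass M G z = j := by
  have hq1 : 1 < Fintype.card F := Fintype.one_lt_card
  have main : ∀ u : Fin d → F, u ≠ 0 →
      0 < lineCount (Fintype.card F) M.rank e (InCol M G u) j →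
      ∃ z : Matrix (Fin d) (Fin e) F, z.rank = 1 ∧ matClass M G z = j := by
    intro u hu hpos
    rw [← sum_pairClass hG hu] at hpos
    obtain ⟨v, hv, hvj⟩ := Finset.exists_ne_zero_of_sum_ne_zero hpos.ne'
    have hv0 := Finset.ne_of_mem_erase hv
    refine ⟨_, rank_vecMulVec_eq_one hu hv0, ?_⟩
    rw [matClass_vecMulVec hu hv0]
    by_contra h
    exact hvj (if_neg h)
  obtain ⟨u₁, hu₁, h₁⟩ := exists_inCol hG (by lia)
  obtain ⟨u₂, hu₂, h₂⟩ := exists_not_inCol hG hd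
  have hm1 := main u₁ hu₁
  have hm2 := main u₂ hu₂
  rw [lineCount, if_pos h₁] at hm1
  rw [lineCount, if_neg h₂] at hm2
  have hq3 : (3 : ℤ) ≤ Fintype.card F := by exact_mod_cast (by lia : 3 ≤ Fintype.card F)
  have hQ : (1 : ℤ) < (Fintype.card F : ℤ) ^ (M.rank - 1) := one_lt_pow₀ (by lia) (by lia)
  have hK : (Fintype.card F : ℤ) ^ M.rank =
      Fintype.card F * (Fintype.card F : ℤ) ^ (M.rank - 1) := by
    rw [← pow_succ', Nat.sub_add_cancel (by lia)]
  have hE : (Fintype.card F : ℤ) ^ M.rank < (Fintype.card F : ℤ) ^ e :=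
    pow_lt_pow_right₀ (by lia) he
  fin_cases j <;> simp only [Fin.reduceFinMk, Fin.zero_eta, Fin.mk_one, cons_val] at hm1 hm2 ⊢
  · exact hm1 (by linarith)
  · exact hm1 (by linarith)
  · exact hm1 (by rw [hK]; nlinarith)
  · exact hm1 (by linarith)
  · exact hm2 (by rw [hK]; nlinarith)
  · exact hm2 (by linarith)

theorem exists_isEquitablePartition (hq : Fintype.card F ≠ 2) {x y : Matrix (Fin d) (Fin e) F}
    (hM : 2 ≤ (y - x).rank) (hd : (y - x).rank < d) (hde : d < e) :
    ∃ C, IsEquitablePartition (bilinearFormsGraph F d e)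
      (distSphere (bilinearFormsGraph F d e) 1 x) (yPartition x y) C := by
  obtain ⟨G, hG⟩ := exists_generalized_inverse (y - x)
  have hO := yPartition_eq hG (by lia) hd hde
  -- Each entry is shown below to equal a cardinality, so `toNat` loses nothing.
  refine ⟨Matrix.of fun i j => (neighborCount (Fintype.card F) (y - x).rank d e i j).toNat,
    ?_, ?_, ?_, ?_⟩
  · intro i
    obtain ⟨z, hz, hzi⟩ := exists_matClass_eq hq hG hM hd (hd.trans hde) i
    refine ⟨z + x, ?_⟩
    rw [hO, Finset.mem_filter, add_sub_cancel_right]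
    exact ⟨Finset.mem_univ _, hz, hzi⟩
  · intro i j hij
    rw [Finset.disjoint_left]
    intro z hzi hzj
    rw [hO, Finset.mem_filter] at hzi hzj
    exact hij (hzi.2.2.symm.trans hzj.2.2)
  · ext z
    simp only [Finset.mem_biUnion, Finset.mem_univ, true_and, hO, Finset.mem_filter, mem_distSphere,
      exists_and_left, exists_eq', and_true]
    rw [rank_sub_comm]
  · intro i j z hz
    rw [hO, Finset.mem_filter] at hz
    have h := card_neighbors_matClass hG hz.2.1 j
    rw [hz.2.2] at h
    rw [of_apply, ← h, Int.toNat_natCast, hO]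
    refine Finset.card_nbij' (fun w => w - x) (fun w => w + x) ?_ ?_ (by intro; simp)
      (by intro; simp)
    · intro w hw
      simp only [Finset.coe_inter, Set.mem_inter_iff, Finset.mem_coe, mem_distSphere,
        Finset.mem_filter, Finset.mem_univ, true_and] at hw
      simp only [Finset.coe_filter, Finset.mem_univ, true_and, Set.mem_ofPred_eq,
        sub_sub_sub_cancel_right]
      rw [rank_sub_comm w z]
      exact ⟨hw.2.1, hw.1, hw.2.2⟩
    · intro w hw
      simp only [Finset.coe_filter, Finset.mem_univ, true_and, Set.mem_ofPred_eq] at hw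
      simp only [Finset.coe_inter, Set.mem_inter_iff, Finset.mem_coe, mem_distSphere,
        Finset.mem_filter, Finset.mem_univ, true_and, add_sub_cancel_right]
      refine ⟨?_, hw.1, hw.2.2⟩
      rw [rank_sub_comm]
      have : w + x - z = w - (z - x) := by abel
      rw [this]
      exact hw.2.1

end YPartition

/-! ### The product formula and invariance of S under E x̂. -/

section NortonAlgebra

open Matrix Module

section General

variable {X : Type*} [Fintype X] [DecidableEq X]

/-- The Norton product by a fixed element, as a linear map. -/
def nortonMulLeft (E : Matrix X X ℝ) (u : imageSpace E) : imageSpace E →ₗ[ℝ] imageSpace E :=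
  E.mulVecLin.rangeRestrict ∘ₗ LinearMap.mulLeft ℝ (u : X → ℝ) ∘ₗ (imageSpace E).subtype

omit [DecidableEq X] in
theorem nortonMulLeft_apply (E : Matrix X X ℝ) (u v : imageSpace E) :
    nortonMulLeft E u v = nortonMul E u v := rfl

omit [DecidableEq X] in
theorem toImage_eq_rangeRestrict (E : Matrix X X ℝ) (v : X → ℝ) :
    toImage E v = E.mulVecLin.rangeRestrict v := rfl

omit [Fintype X] in
theorem charVec_eq_sum (Ω : Finset X) : charVec Ω = ∑ z ∈ Ω, Pi.single z (1 : ℝ) := rfl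

end General

variable {F : Type*} [Field F] [Fintype F] [DecidableEq F] {d e : ℕ}

theorem nortonMul_single_single (hd : 0 < d) (he : 0 < e) {x z : Matrix (Fin d) (Fin e) F}
    (hz : (z - x).rank = 1) :
    nortonMul (bilinearIdempotent F d e) (toImage _ (Pi.single x 1)) (toImage _ (Pi.single z 1)) =
      (Fintype.card (Matrix (Fin d) (Fin e) F) : ℝ)⁻¹ • toImage (bilinearIdempotent F d e)
        (charVec (distSphere (bilinearFormsGraph F d e) 1 x ∩
          distSphere (bilinearFormsGraph F d e) 1 z)) := by
  rw [toImage_eq_rangeRestrict _ (charVec _), ← map_smul]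
  apply Subtype.ext
  have h := norton_single_single hz
  rw [← bilinearIdempotent_eq_dualProj hd he] at h
  exact h

theorem nortonMul_single_charVec (hd : 0 < d) (he : 0 < e) {x : Matrix (Fin d) (Fin e) F} {n : ℕ}
    {O : Fin n → Finset (Matrix (Fin d) (Fin e) F)} {C : Matrix (Fin n) (Fin n) ℕ}
    (h : IsEquitablePartition (bilinearFormsGraph F d e)
      (distSphere (bilinearFormsGraph F d e) 1 x) O C) (j : Fin n) :
    nortonMul (bilinearIdempotent F d e) (toImage _ (Pi.single x 1)) (toImage _ (charVec (O j))) =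
      (Fintype.card (Matrix (Fin d) (Fin e) F) : ℝ)⁻¹ •
        ∑ i, (C i j : ℝ) • toImage (bilinearIdempotent F d e) (charVec (O i)) := by
  have hO : ∀ z ∈ O j, (z - x).rank = 1 := by
    intro z hz
    have : z ∈ distSphere (bilinearFormsGraph F d e) 1 x :=
      h.cover ▸ Finset.mem_biUnion.2 ⟨j, Finset.mem_univ j, hz⟩
    rwa [mem_distSphere, rank_sub_comm] at this
  have hsum := congrArg (bilinearIdempotent F d e).mulVecLin.rangeRestrict (h.sum_charVec j)
  rw [map_sum, map_sum] at hsum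
  simp only [map_smul, ← toImage_eq_rangeRestrict] at hsum
  rw [← hsum, Finset.smul_sum, ← nortonMulLeft_apply, toImage_eq_rangeRestrict _ (charVec (O j)),
    charVec_eq_sum, map_sum, map_sum]
  refine Finset.sum_congr rfl fun z hz => ?_
  rw [nortonMulLeft_apply, ← toImage_eq_rangeRestrict]
  exact nortonMul_single_single hd he (hO z hz)

theorem nortonMul_single_mem_spaceS (hq : Fintype.card F ≠ 2) {x y : Matrix (Fin d) (Fin e) F}
    (hM : 2 ≤ (y - x).rank) (hd : (y - x).rank < d) (hde : d < e) :
    ∀ s ∈ spaceS x y, nortonMul (bilinearIdempotent F d e) (toImage _ (Pi.single x 1)) s ∈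
      spaceS x y := by
  obtain ⟨C, hC⟩ := exists_isEquitablePartition hq hM hd hde
  intro s hs
  rw [← nortonMulLeft_apply]
  have hle : spaceS x y ≤ (spaceS x y).comap
      (nortonMulLeft (bilinearIdempotent F d e) (toImage _ (Pi.single x 1))) := by
    conv_lhs => rw [spaceS]
    rw [Submodule.span_le]
    rintro _ ⟨j, rfl⟩
    rw [SetLike.mem_coe, Submodule.mem_comap, nortonMulLeft_apply,
      nortonMul_single_charVec (by lia) (by lia) hC]
    exact Submodule.smul_mem _ _ (Submodule.sum_mem _ fun i _ => Submodule.smul_mem _ _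
      (Submodule.subset_span ⟨i, rfl⟩))
  exact hle hs

end NortonAlgebra

/-! ### Character sums over rank one matrices with factors in given subspaces. -/

section ClassSums

open Matrix Module

variable {F : Type*} [Field F] [Fintype F] [DecidableEq F] {d e : ℕ}

open Classical in
theorem sum_mem_fieldChar {n : ℕ} (A : Submodule F (Fin n → F)) (w : Fin n → F) :
    ∑ u, (if u ∈ A then fieldChar F (w ⬝ᵥ u) else 0) =
      if ∀ u ∈ A, w ⬝ᵥ u = 0 then ((Finset.univ.filter (· ∈ A)).card : ℂ) else 0 := by
  have h := sum_fieldChar_linearMap ((dotProductBilin F F w).domRestrict A)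
  rw [← Finset.sum_filter, Finset.sum_subtype (p := (· ∈ A)) _ (by simp), ← Fintype.card_subtype]
  refine Eq.trans h ?_
  congr 1
  rw [eq_iff_iff]
  constructor
  · intro h0 u hu
    exact LinearMap.congr_fun h0 ⟨u, hu⟩
  · intro h0
    ext u
    exact h0 u u.2

open Classical in
theorem card_mul_card_orthogonal {n : ℕ} {A : Submodule F (Fin n → F)} {a : Fin n → F}
    (ha : ∃ u ∈ A, a ⬝ᵥ u ≠ 0) :
    Fintype.card F * (Finset.univ.filter fun u => u ∈ A ∧ a ⬝ᵥ u = 0).card =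
      (Finset.univ.filter (· ∈ A)).card := by
  obtain ⟨u₀, hu₀, h₀⟩ := ha
  have hf : (dotProductBilin F F a).domRestrict A ≠ 0 :=
    fun h => h₀ (LinearMap.congr_fun h ⟨u₀, hu₀⟩)
  have h := card_mul_card_fiber hf 0
  rw [Fintype.card_subtype] at h
  rw [← h]
  congr 1
  symm
  refine Finset.card_bij (fun u _ => u.1) ?_ (fun _ _ _ _ => Subtype.ext) ?_
  · intro u hu
    rw [Finset.mem_filter] at hu ⊢
    exact ⟨Finset.mem_univ _, u.2, hu.2⟩
  · intro u hu
    rw [Finset.mem_filter] at hu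
    exact ⟨⟨u, hu.2.1⟩, by rw [Finset.mem_filter]; exact ⟨Finset.mem_univ _, hu.2.2⟩, rfl⟩

open Classical in
-- The sum over v ∈ B is |B| if a·u = 0 and vanishes otherwise, and a proportion 1/q of the u ∈ A
-- satisfies a·u = 0.
theorem card_mul_sum_sum_fieldChar {A : Submodule F (Fin d → F)} {B : Submodule F (Fin e → F)}
    {a : Fin d → F} {b : Fin e → F} (ha : ∃ u ∈ A, a ⬝ᵥ u ≠ 0) (hb : ∃ v ∈ B, b ⬝ᵥ v ≠ 0) :
    (Fintype.card F : ℂ) * ∑ u, ∑ v, (if u ∈ A ∧ v ∈ B then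
        fieldChar F (-((a ⬝ᵥ u) * (b ⬝ᵥ v))) else 0) =
      (Finset.univ.filter (· ∈ A)).card * (Finset.univ.filter (· ∈ B)).card := by
  have h1 : ∀ u : Fin d → F, ∑ v, (if u ∈ A ∧ v ∈ B then
      fieldChar F (-((a ⬝ᵥ u) * (b ⬝ᵥ v))) else 0) =
        if u ∈ A ∧ a ⬝ᵥ u = 0 then ((Finset.univ.filter (· ∈ B)).card : ℂ) else 0 := by
    intro u
    by_cases hu : u ∈ A
    · have h := sum_mem_fieldChar B ((-(a ⬝ᵥ u)) • b)
      simp only [smul_dotProduct, smul_eq_mul] at h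
      simp only [hu, true_and, ← neg_mul]
      rw [h]
      congr 1
      rw [eq_iff_iff]
      constructor
      · intro h0
        obtain ⟨v, hv, hbv⟩ := hb
        simpa [hbv] using h0 v hv
      · intro h0 v _
        rw [h0, neg_zero, zero_mul]
    · simp [hu]
  simp only [h1]
  rw [← Finset.sum_filter, Finset.sum_const, nsmul_eq_mul, ← mul_assoc, ← Nat.cast_mul,
    card_mul_card_orthogonal ha]

open Classical in
-- The full sum over A × B, minus the pairs with a zero factor, each of which contributes 1. The
-- value does not depend on a and b.
theorem sum_rankOnes_subspaces {A : Submodule F (Fin d → F)} {B : Submodule F (Fin e → F)}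
    {P : Matrix (Fin d) (Fin e) F → Prop}
    (hP : ∀ u v, u ≠ 0 → v ≠ 0 → (P (vecMulVec u v) ↔ u ∈ A ∧ v ∈ B))
    {a : Fin d → F} {b : Fin e → F} (ha : ∃ u ∈ A, a ⬝ᵥ u ≠ 0) (hb : ∃ v ∈ B, b ⬝ᵥ v ≠ 0) :
    (Fintype.card F - 1 : ℂ) * ∑ z ∈ rankOnes F d e with P z, matChar (vecMulVec a b) (-z) =
      (Finset.univ.filter (· ∈ A)).card * (Finset.univ.filter (· ∈ B)).card / Fintype.card F -
        (Finset.univ.filter (· ∈ A)).card - (Finset.univ.filter (· ∈ B)).card + 1 := by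
  have hq : 1 ≤ Fintype.card F := Fintype.card_pos
  have hq0 : (Fintype.card F : ℂ) ≠ 0 := by exact_mod_cast Fintype.card_ne_zero
  have h := sum_smul_rankOnes (fun z => if P z then matChar (vecMulVec a b) (-z) else 0)
  rw [nsmul_eq_mul, Nat.cast_sub hq, Nat.cast_one] at h
  rw [Finset.sum_filter, h]
  have h2 : ∀ u v, matChar (vecMulVec a b) (-vecMulVec u v) =
      fieldChar F (-((a ⬝ᵥ u) * (b ⬝ᵥ v))) := by
    intro u v
    rw [← neg_vecMulVec, matChar_vecMulVec_vecMulVec, dotProduct_neg, neg_mul]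
  have h3 : ∀ u ∈ Finset.univ.erase (0 : Fin d → F), ∑ v ∈ Finset.univ.erase (0 : Fin e → F),
      (if P (vecMulVec u v) then matChar (vecMulVec a b) (-vecMulVec u v) else 0) =
      ∑ v, (if u ∈ A ∧ v ∈ B then fieldChar F (-((a ⬝ᵥ u) * (b ⬝ᵥ v))) else 0) -
        if u ∈ A then 1 else 0 := by
    intro u hu
    rw [← Finset.add_sum_erase _ _ (Finset.mem_univ (0 : Fin e → F))]
    simp only [B.zero_mem, and_true, dotProduct_zero, mul_zero, neg_zero, AddChar.map_zero_eq_one,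
      add_sub_cancel_left]
    refine Finset.sum_congr rfl fun v hv => ?_
    simp only [hP u v (Finset.ne_of_mem_erase hu) (Finset.ne_of_mem_erase hv), h2]
  rw [Finset.sum_congr rfl h3, Finset.sum_sub_distrib, Finset.sum_erase_eq_sub (Finset.mem_univ _),
    Finset.sum_erase_eq_sub (Finset.mem_univ _), eq_div_of_mul_eq hq0
      ((mul_comm _ _).trans (card_mul_sum_sum_fieldChar ha hb))]
  simp only [A.zero_mem, true_and, dotProduct_zero, zero_mul, neg_zero, AddChar.map_zero_eq_one,
    if_true, Finset.sum_boole]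
  ring

end ClassSums

/-! ### Character sums with a prescribed value of the pairing. -/

section PairingSums

open Matrix Module

variable {F : Type*} [Field F] [Fintype F] [DecidableEq F] {d e : ℕ}

/-- The sum of a character over the pairs `(u, v)` in the column and row space of `M` with
`vᵀ G u = c`. -/
def pairingSum (M : Matrix (Fin d) (Fin e) F) (G : Matrix (Fin e) (Fin d) F) (a : Fin d → F)
    (b : Fin e → F) (c : F) : ℂ :=
  ∑ u, ∑ v, if InCol M G u ∧ InRow M G v ∧ v ⬝ᵥ (G *ᵥ u) = c then
    fieldChar F (-((a ⬝ᵥ u) * (b ⬝ᵥ v))) else 0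

theorem sum_inRow_fieldChar {M : Matrix (Fin d) (Fin e) F} {G : Matrix (Fin e) (Fin d) F}
    (hG : M * G * M = M) (w : Fin e → F) :
    ∑ v, (if InRow M G v then fieldChar F (w ⬝ᵥ v) else 0) =
      if M *ᵥ w = 0 then (Fintype.card F : ℂ) ^ M.rank else 0 := by
  classical
  have h := sum_mem_fieldChar (LinearMap.range Mᵀ.mulVecLin) w
  have hc := card_filter_inRow hG
  simp only [inRow_iff_mem_range hG] at hc ⊢
  rw [← Nat.cast_pow, ← hc]
  have hiff : (∀ v ∈ LinearMap.range Mᵀ.mulVecLin, w ⬝ᵥ v = 0) ↔ M *ᵥ w = 0 := by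
    constructor
    · intro h0
      apply dotProduct_eq_zero
      intro r
      have := h0 _ ⟨r, rfl⟩
      rwa [mulVecLin_apply, mulVec_transpose, dotProduct_comm, ← dotProduct_mulVec,
        dotProduct_comm] at this
    · rintro h0 _ ⟨r, rfl⟩
      rw [mulVecLin_apply, mulVec_transpose, dotProduct_comm, ← dotProduct_mulVec, h0,
        dotProduct_zero]
  simp only [hiff] at h
  convert h

/-- The condition vᵀGu = c is detected by a character sum over l. The sum over v in the row space
then vanishes unless `M` kills l Gu - (a·u) b, that is, unless l u = (a·u) Mb. -/
theorem card_mul_pairingSum {M : Matrix (Fin d) (Fin e) F} {G : Matrix (Fin e) (Fin d) F}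
    (hG : M * G * M = M) (a : Fin d → F) (b : Fin e → F) (c : F) :
    (Fintype.card F : ℂ) * pairingSum M G a b c = ∑ l : F, fieldChar F (-(l * c)) *
      ((Fintype.card F : ℂ) ^ M.rank *
        (Finset.univ.filter fun u => InCol M G u ∧ l • u = (a ⬝ᵥ u) • (M *ᵥ b)).card) := by
  have hT : ∀ (l : F) (u : Fin d → F), InCol M G u →
      ∑ v, (if InRow M G v then fieldChar F (l * (v ⬝ᵥ (G *ᵥ u)) - (a ⬝ᵥ u) * (b ⬝ᵥ v)) else 0) =
        if l • u = (a ⬝ᵥ u) • (M *ᵥ b) then (Fintype.card F : ℂ) ^ M.rank else 0 := by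
    intro l u hu
    have h := sum_inRow_fieldChar hG (l • (G *ᵥ u) - (a ⬝ᵥ u) • b)
    simp only [mulVec_sub, mulVec_smul, hu.eq, sub_eq_zero, sub_dotProduct, smul_dotProduct,
      smul_eq_mul] at h
    rw [← h]
    exact Finset.sum_congr rfl fun v _ => by rw [dotProduct_comm v]
  have hδ : ∀ t : F, ∑ l : F, fieldChar F (l * (t - c)) =
      if t = c then (Fintype.card F : ℂ) else 0 := by
    intro t
    classical
    have h := sum_fieldChar_linearMap (LinearMap.mulRight F (t - c))
    simp only [LinearMap.mulRight_apply] at h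
    rw [h]
    congr 1
    rw [LinearMap.mulRight_eq_zero_iff, sub_eq_zero]
  have h1 : ∀ (l : F), (Fintype.card F : ℂ) ^ M.rank *
      (Finset.univ.filter fun u => InCol M G u ∧ l • u = (a ⬝ᵥ u) • (M *ᵥ b)).card =
      ∑ u, ∑ v, if InCol M G u ∧ InRow M G v then
        fieldChar F (l * (v ⬝ᵥ (G *ᵥ u)) - (a ⬝ᵥ u) * (b ⬝ᵥ v)) else 0 := by
    intro l
    rw [mul_comm, ← nsmul_eq_mul, ← Finset.sum_const, Finset.sum_filter]
    refine Finset.sum_congr rfl fun u _ => ?_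
    by_cases hu : InCol M G u
    · simp only [hu, true_and]
      rw [hT l u hu]
    · simp [hu]
  simp only [h1]
  simp only [pairingSum, Finset.mul_sum]
  symm
  rw [Finset.sum_comm]
  refine Finset.sum_congr rfl fun u _ => ?_
  rw [Finset.sum_comm]
  refine Finset.sum_congr rfl fun v _ => ?_
  by_cases huv : InCol M G u ∧ InRow M G v
  · have h2 : ∀ l : F, fieldChar F (-(l * c)) *
        fieldChar F (l * (v ⬝ᵥ (G *ᵥ u)) - (a ⬝ᵥ u) * (b ⬝ᵥ v)) =
          fieldChar F (l * (v ⬝ᵥ (G *ᵥ u) - c)) * fieldChar F (-((a ⬝ᵥ u) * (b ⬝ᵥ v))) := by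
      intro l
      rw [← AddChar.map_add_eq_mul, ← AddChar.map_add_eq_mul]
      congr 1
      ring
    simp only [huv, and_self, true_and, if_true, h2]
    rw [← Finset.sum_mul, hδ]
    split_ifs <;> simp
  · rw [if_neg (fun h => huv ⟨h.1, h.2.1⟩), mul_zero]
    simp only [if_neg huv, mul_zero, Finset.sum_const_zero]

/-- A solution is a multiple of Mb, and pairing it with `a` gives l (a·u) = (a·u)(a·Mb). If l = a·Mb
every multiple of Mb works; otherwise a·u = 0, which forces u = 0. -/
theorem card_filter_smul_eq_smul {M : Matrix (Fin d) (Fin e) F} {G : Matrix (Fin e) (Fin d) F}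
    (hG : M * G * M = M) (a : Fin d → F) (b : Fin e → F) {l : F} (hl : l ≠ 0) :
    (Finset.univ.filter fun u => InCol M G u ∧ l • u = (a ⬝ᵥ u) • (M *ᵥ b)).card =
      if l = a ⬝ᵥ (M *ᵥ b) then Fintype.card F else 1 := by
  split_ifs with hs
  · have hMb : M *ᵥ b ≠ 0 := by
      intro h0
      rw [h0, dotProduct_zero] at hs
      exact hl hs
    rw [← Finset.card_univ (α := F), ← Finset.card_image_of_injective Finset.univ
      (smul_left_injective F hMb)]
    congr 1
    ext u
    simp only [Finset.mem_filter, Finset.mem_univ, true_and, Finset.mem_image]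
    constructor
    · rintro ⟨-, h⟩
      exact ⟨l⁻¹ * (a ⬝ᵥ u), by rw [mul_smul, ← h, smul_smul, inv_mul_cancel₀ hl, one_smul]⟩
    · rintro ⟨c, rfl⟩
      refine ⟨?_, ?_⟩
      · rw [← mulVec_smul]
        exact inCol_mulVec hG _
      · rw [dotProduct_smul, ← hs, smul_smul, smul_eq_mul, mul_comm]
  · rw [Finset.card_eq_one]
    refine ⟨0, ?_⟩
    ext u
    simp only [Finset.mem_filter, Finset.mem_univ, true_and, Finset.mem_singleton]
    constructor
    · rintro ⟨-, h⟩
      have h1 := congrArg (a ⬝ᵥ ·) h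
      simp only [dotProduct_smul, smul_eq_mul] at h1
      have h2 : a ⬝ᵥ u = 0 := by
        by_contra h0
        exact hs (mul_right_cancel₀ h0 (by rw [h1, mul_comm]))
      rw [h2, zero_smul, smul_eq_zero] at h
      exact h.resolve_left hl
    · rintro rfl
      exact ⟨by rw [InCol, mulVec_zero, mulVec_zero], by simp⟩

omit [DecidableEq F] in
theorem sum_fieldChar_neg : ∑ l : F, fieldChar F (-l) = 0 := by
  classical
  have h := sum_fieldChar_linearMap (-LinearMap.id : F →ₗ[F] F)
  rw [if_neg] at h
  · simpa using h
  · intro h0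
    have := LinearMap.congr_fun h0 1
    simp at this

/-- In the difference the term l = 0 cancels, so the only count that depends on whether a·Mb
vanishes drops out and the formula needs no case distinction. -/
theorem pairingSum_one_sub_pairingSum_zero {M : Matrix (Fin d) (Fin e) F}
    {G : Matrix (Fin e) (Fin d) F} (hG : M * G * M = M) (a : Fin d → F) (b : Fin e → F) :
    (Fintype.card F : ℂ) * (pairingSum M G a b 1 - pairingSum M G a b 0) =
      (Fintype.card F : ℂ) ^ M.rank * ((Fintype.card F - 1) *
        (fieldChar F (-(a ⬝ᵥ (M *ᵥ b))) - 1) - Fintype.card F) := by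
  have hterm : ∀ l : F, fieldChar F (-(l * 1)) * ((Fintype.card F : ℂ) ^ M.rank *
      (Finset.univ.filter fun u => InCol M G u ∧ l • u = (a ⬝ᵥ u) • (M *ᵥ b)).card) -
      fieldChar F (-(l * 0)) * ((Fintype.card F : ℂ) ^ M.rank *
      (Finset.univ.filter fun u => InCol M G u ∧ l • u = (a ⬝ᵥ u) • (M *ᵥ b)).card) =
      (Fintype.card F : ℂ) ^ M.rank * ((fieldChar F (-l) - 1) +
        if l = a ⬝ᵥ (M *ᵥ b) then (Fintype.card F - 1) * (fieldChar F (-l) - 1) else 0) := by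
    intro l
    by_cases hl : l = 0
    · subst hl
      simp
    · rw [card_filter_smul_eq_smul hG a b hl, mul_one, mul_zero, neg_zero,
        AddChar.map_zero_eq_one]
      split_ifs
      · ring
      · push_cast
        ring
  rw [mul_sub, card_mul_pairingSum hG, card_mul_pairingSum hG, ← Finset.sum_sub_distrib,
    Finset.sum_congr rfl fun l _ => hterm l, ← Finset.mul_sum, Finset.sum_add_distrib,
    Finset.sum_sub_distrib, sum_fieldChar_neg, Finset.sum_ite_eq', if_pos (Finset.mem_univ _)]
  simp
  ring

/-- The term l = 0 counts the u in the column space with a·u = 0, which are a proportion 1/q because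
a·Mb ≠ 0. Of the other terms only l = a·Mb has q solutions, the rest having one. -/
theorem pairingSum_zero_of_ne {M : Matrix (Fin d) (Fin e) F} {G : Matrix (Fin e) (Fin d) F}
    (hG : M * G * M = M) {a : Fin d → F} {b : Fin e → F} (hs : a ⬝ᵥ (M *ᵥ b) ≠ 0) :
    (Fintype.card F : ℂ) ^ 2 * pairingSum M G a b 0 = (Fintype.card F : ℂ) ^ M.rank *
      ((Fintype.card F : ℂ) ^ M.rank + 2 * Fintype.card F * (Fintype.card F - 1)) := by
  classical
  have hMb : M *ᵥ b ≠ 0 := by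
    intro h0
    rw [h0, dotProduct_zero] at hs
    exact hs rfl
  have h0 : Fintype.card F *
      (Finset.univ.filter fun u => InCol M G u ∧ (0 : F) • u = (a ⬝ᵥ u) • (M *ᵥ b)).card =
        Fintype.card F ^ M.rank := by
    have h := card_mul_card_orthogonal (A := LinearMap.range M.mulVecLin) (a := a)
      ⟨_, ⟨b, rfl⟩, hs⟩
    have hc := card_filter_inCol hG
    simp only [inCol_iff_mem_range hG, zero_smul, eq_comm (a := (0 : Fin d → F)), smul_eq_zero, hMb,
      or_false] at hc ⊢
    rw [← hc]
    convert h
  have hterm : ∀ l ∈ Finset.univ.erase (0 : F), fieldChar F (-(l * 0)) *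
      ((Fintype.card F : ℂ) ^ M.rank *
      (Finset.univ.filter fun u => InCol M G u ∧ l • u = (a ⬝ᵥ u) • (M *ᵥ b)).card) =
      (Fintype.card F : ℂ) ^ M.rank * (1 +
        if l = a ⬝ᵥ (M *ᵥ b) then (Fintype.card F - 1 : ℂ) else 0) := by
    intro l hl
    rw [card_filter_smul_eq_smul hG a b (Finset.ne_of_mem_erase hl), mul_zero, neg_zero,
      AddChar.map_zero_eq_one]
    split_ifs
    · ring
    · push_cast
      ring
  rw [pow_two, mul_assoc, card_mul_pairingSum hG,
    ← Finset.add_sum_erase _ _ (Finset.mem_univ (0 : F)), Finset.sum_congr rfl hterm,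
    ← Finset.mul_sum, Finset.sum_add_distrib, Finset.sum_ite_eq', if_pos (by simpa using hs),
    mul_zero, neg_zero, AddChar.map_zero_eq_one, one_mul, mul_add, mul_left_comm, ← Nat.cast_mul, h0,
    Finset.sum_const, Finset.card_erase_of_mem (Finset.mem_univ _), Finset.card_univ, nsmul_eq_mul,
    Nat.cast_sub Fintype.card_pos]
  push_cast
  ring

/-- The sum of the character `χ_C(-z)` over the rank one matrices `z` of class `i`. -/
def classSum (M : Matrix (Fin d) (Fin e) F) (G : Matrix (Fin e) (Fin d) F) (i : Fin 6)
    (C : Matrix (Fin d) (Fin e) F) : ℂ :=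
  ∑ z ∈ rankOnes F d e with matClass M G z = i, matChar C (-z)

theorem card_sub_one_mul_classSum (M : Matrix (Fin d) (Fin e) F) (G : Matrix (Fin e) (Fin d) F)
    (i : Fin 6) (a : Fin d → F) (b : Fin e → F) :
    (Fintype.card F - 1 : ℂ) * classSum M G i (vecMulVec a b) =
      ∑ u ∈ Finset.univ.erase 0, ∑ v ∈ Finset.univ.erase 0, if pairClass M G u v = i then
        fieldChar F (-((a ⬝ᵥ u) * (b ⬝ᵥ v))) else 0 := by
  have hq : 1 ≤ Fintype.card F := Fintype.card_pos
  have h := sum_smul_rankOnes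
    (fun z => if matClass M G z = i then matChar (vecMulVec a b) (-z) else 0)
  rw [nsmul_eq_mul, Nat.cast_sub hq, Nat.cast_one] at h
  rw [classSum, Finset.sum_filter, h]
  refine Finset.sum_congr rfl fun u hu => Finset.sum_congr rfl fun v hv => ?_
  rw [matClass_vecMulVec (Finset.ne_of_mem_erase hu) (Finset.ne_of_mem_erase hv),
    ← neg_vecMulVec, matChar_vecMulVec_vecMulVec, dotProduct_neg, neg_mul]

omit [Fintype F] in
theorem pairClass_eq_zero_iff {M : Matrix (Fin d) (Fin e) F} {G : Matrix (Fin e) (Fin d) F}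
    {u : Fin d → F} {v : Fin e → F} :
    pairClass M G u v = 0 ↔ InCol M G u ∧ InRow M G v ∧ v ⬝ᵥ (G *ᵥ u) = 1 := by
  rw [pairClass]
  split_ifs with h1 h2 h3 h4 h5 <;> simp [*]

omit [Fintype F] in
theorem pairClass_eq_one_iff {M : Matrix (Fin d) (Fin e) F} {G : Matrix (Fin e) (Fin d) F}
    {u : Fin d → F} {v : Fin e → F} :
    pairClass M G u v = 1 ↔ InCol M G u ∧ InRow M G v ∧ v ⬝ᵥ (G *ᵥ u) = 0 := by
  rw [pairClass]
  split_ifs with h1 h2 h3 h4 h5 <;> simp [*]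

theorem classSum_zero_eq (M : Matrix (Fin d) (Fin e) F) (G : Matrix (Fin e) (Fin d) F)
    (a : Fin d → F) (b : Fin e → F) :
    (Fintype.card F - 1 : ℂ) * classSum M G 0 (vecMulVec a b) = pairingSum M G a b 1 := by
  rw [card_sub_one_mul_classSum, pairingSum]
  simp only [pairClass_eq_zero_iff]
  refine (Finset.sum_congr rfl fun u _ => Finset.sum_erase _ (by simp)).trans
    (Finset.sum_erase _ (Finset.sum_eq_zero fun v _ => by simp))

/-- Pairs with a zero factor have pairing 0 and character value 1; there are 2 q^k - 1 of them, with
k the rank of `M`, and they must be removed. -/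
theorem classSum_one_eq {M : Matrix (Fin d) (Fin e) F} {G : Matrix (Fin e) (Fin d) F}
    (hG : M * G * M = M) (a : Fin d → F) (b : Fin e → F) :
    (Fintype.card F - 1 : ℂ) * classSum M G 1 (vecMulVec a b) =
      pairingSum M G a b 0 - (2 * (Fintype.card F : ℂ) ^ M.rank - 1) := by
  have h0row : InRow M G (0 : Fin e → F) := by rw [InRow, zero_vecMul, zero_vecMul]
  have h0col : InCol M G (0 : Fin d → F) := by rw [InCol, mulVec_zero, mulVec_zero]
  rw [card_sub_one_mul_classSum, pairingSum]
  simp only [pairClass_eq_one_iff]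
  have h1 : ∀ u : Fin d → F, ∑ v ∈ Finset.univ.erase (0 : Fin e → F),
      (if InCol M G u ∧ InRow M G v ∧ v ⬝ᵥ (G *ᵥ u) = 0 then
        fieldChar F (-((a ⬝ᵥ u) * (b ⬝ᵥ v))) else 0) =
      ∑ v, (if InCol M G u ∧ InRow M G v ∧ v ⬝ᵥ (G *ᵥ u) = 0 then
        fieldChar F (-((a ⬝ᵥ u) * (b ⬝ᵥ v))) else 0) - if InCol M G u then 1 else 0 := by
    intro u
    rw [Finset.sum_erase_eq_sub (Finset.mem_univ _)]
    simp [h0row]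
  simp only [h1]
  rw [Finset.sum_sub_distrib, Finset.sum_erase_eq_sub (Finset.mem_univ _),
    Finset.sum_erase_eq_sub (Finset.mem_univ _), Finset.sum_boole, card_filter_inCol hG]
  simp only [h0col, true_and, mulVec_zero, dotProduct_zero, and_true, zero_mul, neg_zero,
    AddChar.map_zero_eq_one, if_true]
  rw [Finset.sum_boole, card_filter_inRow hG]
  push_cast
  ring

end PairingSums

/-! ### Dependence of the class sums on the character. -/

section Symmetry

open Matrix Module

variable {F : Type*} [Field F] [Fintype F] [DecidableEq F] {d e : ℕ}

theorem classSum_zero_sub_classSum_one {M : Matrix (Fin d) (Fin e) F}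
    {G : Matrix (Fin e) (Fin d) F} (hG : M * G * M = M) (hM : 0 < M.rank)
    {C : Matrix (Fin d) (Fin e) F} (hC : C.rank = 1) :
    classSum M G 0 C - classSum M G 1 C = (Fintype.card F : ℂ) ^ (M.rank - 1) * matChar C (-M) +
      ((Fintype.card F : ℂ) ^ (M.rank - 1) - 1) / (Fintype.card F - 1) := by
  obtain ⟨a, b, -, -, rfl⟩ := exists_vecMulVec_of_rank_eq_one hC
  have hq0 : (Fintype.card F : ℂ) ≠ 0 := by exact_mod_cast Fintype.card_ne_zero
  have hq1 : (Fintype.card F : ℂ) - 1 ≠ 0 := by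
    rw [sub_ne_zero]
    exact_mod_cast Fintype.one_lt_card.ne'
  have h := pairingSum_one_sub_pairingSum_zero hG a b
  have hk : (Fintype.card F : ℂ) ^ M.rank =
      Fintype.card F * (Fintype.card F : ℂ) ^ (M.rank - 1) := by
    rw [← pow_succ', Nat.sub_add_cancel hM]
  have h0 := classSum_zero_eq M G a b
  have h1 := classSum_one_eq hG a b
  rw [hk] at h h1
  rw [mul_assoc] at h
  have h' := mul_left_cancel₀ hq0 h
  rw [matChar_vecMulVec, neg_mulVec, dotProduct_neg]
  apply mul_left_cancel₀ hq1
  rw [mul_add, mul_div_cancel₀ _ hq1]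
  linear_combination h0 - h1 + h'

/-- On the rank one matrices `C` with `χ_C(M) ≠ 1`, the function `g` is a real constant. -/
def ConstantOff (M : Matrix (Fin d) (Fin e) F) (g : Matrix (Fin d) (Fin e) F → ℂ) : Prop :=
  ∃ c : ℝ, ∀ C, C.rank = 1 → matChar C M ≠ 1 → g C = c

omit [DecidableEq F] in
theorem ConstantOff.sub {M : Matrix (Fin d) (Fin e) F} {g h : Matrix (Fin d) (Fin e) F → ℂ}
    (hg : ConstantOff M g) (hh : ConstantOff M h) : ConstantOff M (g - h) := by
  obtain ⟨c, hc⟩ := hg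
  obtain ⟨c', hc'⟩ := hh
  refine ⟨c - c', fun C hC hCM => ?_⟩
  rw [Pi.sub_apply, hc C hC hCM, hc' C hC hCM, Complex.ofReal_sub]

omit [DecidableEq F] in
theorem constantOff_of_mul {M : Matrix (Fin d) (Fin e) F} {g : Matrix (Fin d) (Fin e) F → ℂ}
    {r s : ℝ} (hr : r ≠ 0) (h : ∀ a b, a ⬝ᵥ (M *ᵥ b) ≠ 0 → (r : ℂ) * g (vecMulVec a b) = s) :
    ConstantOff M g := by
  refine ⟨s / r, fun C hC hCM => ?_⟩
  obtain ⟨a, b, -, -, rfl⟩ := exists_vecMulVec_of_rank_eq_one hC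
  have hr' : (r : ℂ) ≠ 0 := by exact_mod_cast hr
  rw [Complex.ofReal_div, eq_div_iff hr', mul_comm]
  refine h a b fun h0 => hCM ?_
  rw [matChar_vecMulVec, h0, AddChar.map_zero_eq_one]

theorem sum_classSum (M : Matrix (Fin d) (Fin e) F) (G : Matrix (Fin e) (Fin d) F)
    (I : Finset (Fin 6)) (C : Matrix (Fin d) (Fin e) F) :
    ∑ i ∈ I, classSum M G i C = ∑ z ∈ rankOnes F d e with matClass M G z ∈ I, matChar C (-z) := by
  simp only [classSum, Finset.sum_filter]
  rw [Finset.sum_comm]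
  exact Finset.sum_congr rfl fun z _ => Finset.sum_ite_eq _ _ _

/-- If χ_C(M) ≠ 1 for C = a bᵀ then aᵀMb ≠ 0, so `a` does not vanish on `A` nor `b` on `B`, and the
subspace formula gives a value independent of `C`. -/
theorem constantOff_sum_classSum {M : Matrix (Fin d) (Fin e) F} {G : Matrix (Fin e) (Fin d) F}
    {A : Submodule F (Fin d → F)} {B : Submodule F (Fin e → F)} {I : Finset (Fin 6)}
    (hA : ∀ b, M *ᵥ b ∈ A) (hB : ∀ a, a ᵥ* M ∈ B)
    (hI : ∀ u v, pairClass M G u v ∈ I ↔ u ∈ A ∧ v ∈ B) :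
    ConstantOff M (fun C => ∑ i ∈ I, classSum M G i C) := by
  classical
  refine constantOff_of_mul (r := Fintype.card F - 1)
    (s := (Finset.univ.filter (· ∈ A)).card * (Finset.univ.filter (· ∈ B)).card / Fintype.card F -
        (Finset.univ.filter (· ∈ A)).card - (Finset.univ.filter (· ∈ B)).card + 1)
    (sub_ne_zero.2 (one_lt_card_real (F := F)).ne') fun a b hab => ?_
  rw [sum_classSum]
  have h := sum_rankOnes_subspaces (A := A) (B := B) (P := fun z => matClass M G z ∈ I)
    (fun u v hu hv => by rw [matClass_vecMulVec hu hv, hI]) ⟨_, hA b, hab⟩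
    ⟨_, hB a, by rwa [dotProduct_comm, ← dotProduct_mulVec]⟩
  push_cast
  convert h

theorem constantOff_classSum_one {M : Matrix (Fin d) (Fin e) F} {G : Matrix (Fin e) (Fin d) F}
    (hG : M * G * M = M) : ConstantOff M (classSum M G 1) := by
  have hq0 : (Fintype.card F : ℂ) ≠ 0 := by exact_mod_cast Fintype.card_ne_zero
  refine constantOff_of_mul (r := Fintype.card F - 1)
    (s := (Fintype.card F : ℝ) ^ M.rank *
      ((Fintype.card F : ℝ) ^ M.rank + 2 * Fintype.card F * (Fintype.card F - 1)) /
        (Fintype.card F : ℝ) ^ 2 - (2 * (Fintype.card F : ℝ) ^ M.rank - 1))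
    (sub_ne_zero.2 (one_lt_card_real (F := F)).ne') fun a b hab => ?_
  have h := pairingSum_zero_of_ne hG hab
  push_cast
  rw [classSum_one_eq hG, ← h, mul_div_cancel_left₀ _ (pow_ne_zero 2 hq0)]

/-- The unions {0,1,2}, {0,1,2,3}, {0,1,2,4} and the set of all classes are cut out by subspaces for
`u` and `v`, so inclusion–exclusion isolates classes 3, 4 and 5. Class 1 comes from the pairing sum
at 0. -/
theorem constantOff_classSum {M : Matrix (Fin d) (Fin e) F} {G : Matrix (Fin e) (Fin d) F}
    (hG : M * G * M = M) {i : Fin 6} (hi : i ≠ 0 ∧ i ≠ 2) : ConstantOff M (classSum M G i) := by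
  have hcol : ∀ b, M *ᵥ b ∈ LinearMap.range M.mulVecLin := fun b => ⟨b, rfl⟩
  have hrow : ∀ a, a ᵥ* M ∈ LinearMap.range Mᵀ.mulVecLin :=
    fun a => ⟨a, by rw [mulVecLin_apply, mulVec_transpose]⟩
  have h012 : ConstantOff M (fun C => ∑ i ∈ {0, 1, 2}, classSum M G i C) := by
    refine constantOff_sum_classSum hcol hrow fun u v => ?_
    rw [← inCol_iff_mem_range hG, ← inRow_iff_mem_range hG, inCol_iff_pairClass (v := v),
      inRow_iff_pairClass (u := u)]
    generalize pairClass M G u v = c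
    revert c
    decide
  have h0123 : ConstantOff M (fun C => ∑ i ∈ {0, 1, 2, 3}, classSum M G i C) := by
    refine constantOff_sum_classSum (B := ⊤) hcol (by simp) fun u v => ?_
    rw [← inCol_iff_mem_range hG, inCol_iff_pairClass (v := v)]
    simp
  have h0124 : ConstantOff M (fun C => ∑ i ∈ {0, 1, 2, 4}, classSum M G i C) := by
    refine constantOff_sum_classSum (A := ⊤) (by simp) hrow fun u v => ?_
    rw [← inRow_iff_mem_range hG, inRow_iff_pairClass (u := u)]
    simp
  have hall : ConstantOff M (fun C => ∑ i, classSum M G i C) :=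
    constantOff_sum_classSum (A := ⊤) (B := ⊤) (by simp) (by simp) (by simp)
  fin_cases i
  · exact absurd rfl hi.1
  · exact constantOff_classSum_one hG
  · exact absurd rfl hi.2
  · convert h0123.sub h012 using 1
    funext C
    simp
  · convert h0124.sub h012 using 1
    funext C
    simp
  · convert (hall.sub h0123).sub (h0124.sub h012) using 1
    funext C
    simp [Fin.sum_univ_succ]

/-- Negating `M` and `G` fixes both projections and changes the sign of the pairing, which can only
move matrices between classes 0 and 2. -/
theorem classSum_neg (M : Matrix (Fin d) (Fin e) F) (G : Matrix (Fin e) (Fin d) F) {i : Fin 6}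
    (hi : i ≠ 0 ∧ i ≠ 2) : classSum (-M) (-G) i = classSum M G i := by
  have h : ∀ z, matClass (-M) (-G) z = i ↔ matClass M G z = i := by
    intro z
    simp only [matClass, Matrix.neg_mul, Matrix.mul_neg, neg_neg, trace_neg,
      neg_eq_zero]
    split_ifs <;> simp_all [hi.1.symm, hi.2.symm]
  funext C
  simp only [classSum, h]

theorem matFourier_charVec_yPartition {x y : Matrix (Fin d) (Fin e) F}
    {G : Matrix (Fin e) (Fin d) F} (hG : (y - x) * G * (y - x) = y - x) (hM : 0 < (y - x).rank)
    (hM' : (y - x).rank < d) (hde : d < e) (i : Fin 6) (C : Matrix (Fin d) (Fin e) F) :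
    matFourier (charVec (yPartition x y i)) C = matChar C (-x) * classSum (y - x) G i C := by
  rw [matFourier_charVec, yPartition_eq hG hM hM' hde, classSum, Finset.mul_sum]
  refine Finset.sum_nbij' (fun z => z - x) (fun z => z + x) ?_ ?_ (by simp) (by simp) ?_
  · intro z hz
    rw [Finset.mem_filter] at hz ⊢
    exact ⟨mem_rankOnes.2 hz.2.1, hz.2.2⟩
  · intro z hz
    rw [Finset.mem_filter] at hz ⊢
    rw [add_sub_cancel_right]
    exact ⟨Finset.mem_univ _, mem_rankOnes.1 hz.1, hz.2⟩
  · intro z _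
    rw [← AddChar.map_add_eq_mul]
    congr 1
    abel

end Symmetry

/-! ### S(x,y) contains E x̂ and E ŷ and is symmetric in x and y. -/

section SpaceS

open Matrix Module

variable {F : Type*} [Field F] [Fintype F] [DecidableEq F] {d e : ℕ}

theorem toImage_congr (hd : 0 < d) (he : 0 < e) {u v : Matrix (Fin d) (Fin e) F → ℝ}
    (h : ∀ C, C.rank = 1 → matFourier u C = matFourier v C) :
    toImage (bilinearIdempotent F d e) u = toImage (bilinearIdempotent F d e) v := by
  apply Subtype.ext
  have := dualProj_mulVec_congr neg_mem_rankOnes fun C hC => h C (mem_rankOnes.1 hC)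
  rwa [← bilinearIdempotent_eq_dualProj hd he] at this

theorem toImage_charVec_mem_spaceS (x y : Matrix (Fin d) (Fin e) F) (i : Fin 6) :
    toImage (bilinearIdempotent F d e) (charVec (yPartition x y i)) ∈ spaceS x y :=
  Submodule.subset_span ⟨i, rfl⟩

omit [DecidableEq F] in
theorem matFourier_sum {ι : Type*} (s : Finset ι) (u : ι → Matrix (Fin d) (Fin e) F → ℝ)
    (C : Matrix (Fin d) (Fin e) F) : matFourier (∑ i ∈ s, u i) C = ∑ i ∈ s, matFourier (u i) C := by
  simp only [matFourier, Finset.sum_apply, Complex.ofReal_sum, Finset.mul_sum]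
  exact Finset.sum_comm

theorem sum_classSum_univ (M : Matrix (Fin d) (Fin e) F) (G : Matrix (Fin e) (Fin d) F)
    {C : Matrix (Fin d) (Fin e) F} (hC : C.rank = 1) :
    ∑ i, classSum M G i C = bilinearEigenvalue F d e 1 := by
  rw [sum_classSum]
  simp only [Finset.mem_univ, Finset.filter_true]
  rw [← hC, ← rank_neg_matrix, ← sum_matChar_rankOnes]
  simp only [matChar_neg_left]

omit [Field F] [DecidableEq F] in
theorem bilinearEigenvalue_one_pos [Nontrivial F] (hd : 2 ≤ d) (hde : d < e) :
    0 < bilinearEigenvalue F d e 1 := by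
  have hq : (1 : ℝ) < Fintype.card F := by exact_mod_cast Fintype.one_lt_card
  have hq2 : (2 : ℝ) ≤ Fintype.card F := by exact_mod_cast Fintype.one_lt_card (α := F)
  have h1 : (Fintype.card F : ℝ) ^ d ≤ (Fintype.card F : ℝ) ^ e := pow_le_pow_right₀ hq.le hde.le
  have h2 : (2 : ℝ) ≤ (Fintype.card F : ℝ) ^ (d - 1) :=
    hq2.trans (le_self_pow₀ hq.le (by lia))
  have h3 : (0 : ℝ) < (Fintype.card F : ℝ) ^ e := by positivity
  rw [bilinearEigenvalue]
  -- The numerator is positive since q^e (q^(d-1) - 1) ≥ q^e > q^d - 1.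
  apply div_pos
  · nlinarith
  · linarith

variable {x y : Matrix (Fin d) (Fin e) F}

/-- The sets O_i make up Γ(x), so the vectors E Ô_i sum to θ_1 E x̂, and θ_1 ≠ 0. -/
theorem toImage_single_left_mem_spaceS (hM : 2 ≤ (y - x).rank) (hd : (y - x).rank < d)
    (hde : d < e) : toImage (bilinearIdempotent F d e) (Pi.single x 1) ∈ spaceS x y := by
  obtain ⟨G, hG⟩ := exists_generalized_inverse (y - x)
  have hθ := bilinearEigenvalue_one_pos (F := F) (show 2 ≤ d by lia) hde
  have h : toImage (bilinearIdempotent F d e) (∑ i, charVec (yPartition x y i)) =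
      toImage (bilinearIdempotent F d e) (bilinearEigenvalue F d e 1 • Pi.single x 1) := by
    refine toImage_congr (by lia) (by lia) fun C hC => ?_
    rw [matFourier_sum, matFourier_smul, matFourier_single]
    simp only [matFourier_charVec_yPartition hG (show 0 < (y - x).rank by lia) hd hde]
    rw [← Finset.mul_sum, sum_classSum_univ _ _ hC, mul_comm]
  rw [toImage_eq_rangeRestrict, toImage_eq_rangeRestrict, map_sum, map_smul] at h
  rw [toImage_eq_rangeRestrict, ← inv_smul_smul₀ hθ.ne' ((bilinearIdempotent F d
    e).mulVecLin.rangeRestrict (Pi.single x 1)), ← h]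
  exact Submodule.smul_mem _ _ (Submodule.sum_mem _ fun i _ => toImage_charVec_mem_spaceS x y i)

/-- The relation between `E Ô_1`, `E Ô_2`, `E x̂` and `E ŷ`. -/
theorem toImage_yPartition_zero (hM : 2 ≤ (y - x).rank) (hd : (y - x).rank < d) (hde : d < e) :
    toImage (bilinearIdempotent F d e) (charVec (yPartition x y 0)) =
      toImage (bilinearIdempotent F d e) (charVec (yPartition x y 1)) +
      (Fintype.card F : ℝ) ^ ((y - x).rank - 1) •
        toImage (bilinearIdempotent F d e) (Pi.single y 1) +
      (((Fintype.card F : ℝ) ^ ((y - x).rank - 1) - 1) / (Fintype.card F - 1)) •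
        toImage (bilinearIdempotent F d e) (Pi.single x 1) := by
  obtain ⟨G, hG⟩ := exists_generalized_inverse (y - x)
  simp only [toImage_eq_rangeRestrict]
  rw [← map_smul, ← map_smul, ← map_add, ← map_add]
  refine toImage_congr (by lia) (by lia) fun C hC => ?_
  rw [matFourier_add, matFourier_add, matFourier_smul, matFourier_smul, matFourier_single,
    matFourier_single, matFourier_charVec_yPartition hG (show 0 < (y - x).rank by lia) hd hde,
    matFourier_charVec_yPartition hG (show 0 < (y - x).rank by lia) hd hde]
  have h := classSum_zero_sub_classSum_one hG (by lia) hC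
  have hy : matChar C (-y) = matChar C (-x) * matChar C (-(y - x)) := by
    rw [← AddChar.map_add_eq_mul]
    congr 1
    abel
  rw [hy]
  push_cast
  linear_combination matChar C (-x) * h

/-- In `toImage_yPartition_zero` the coefficient of E ŷ is a power of q, so E ŷ can be solved for.
-/
theorem toImage_single_right_mem_spaceS (hM : 2 ≤ (y - x).rank) (hd : (y - x).rank < d)
    (hde : d < e) : toImage (bilinearIdempotent F d e) (Pi.single y 1) ∈ spaceS x y := by
  have h := toImage_yPartition_zero hM hd hde
  have hq : (Fintype.card F : ℝ) ^ ((y - x).rank - 1) ≠ 0 :=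
    pow_ne_zero _ (by exact_mod_cast Fintype.card_ne_zero)
  rw [← sub_eq_iff_eq_add, ← sub_eq_iff_eq_add'] at h
  rw [← inv_smul_smul₀ hq (toImage _ (Pi.single y 1)), ← h]
  exact Submodule.smul_mem _ _ (Submodule.sub_mem _ (Submodule.sub_mem _
    (toImage_charVec_mem_spaceS x y 0)
    (Submodule.smul_mem _ _ (toImage_single_left_mem_spaceS hM hd hde)))
    (toImage_charVec_mem_spaceS x y 1))

/-- Interchanging `x` and `y` changes `E Ô_i`, for `i ∉ {1, 3}`, by a multiple of `E ŷ - E x̂`. -/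
theorem exists_toImage_yPartition_swap (hM : 2 ≤ (y - x).rank) (hd : (y - x).rank < d)
    (hde : d < e) {i : Fin 6} (hi : i ≠ 0 ∧ i ≠ 2) :
    ∃ c : ℝ, toImage (bilinearIdempotent F d e) (charVec (yPartition y x i)) =
      toImage (bilinearIdempotent F d e) (charVec (yPartition x y i)) +
      (-c) • toImage (bilinearIdempotent F d e) (Pi.single x 1) +
      c • toImage (bilinearIdempotent F d e) (Pi.single y 1) := by
  obtain ⟨G, hG⟩ := exists_generalized_inverse (y - x)
  have hG' : (x - y) * (-G) * (x - y) = x - y := by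
    rw [← neg_sub y x, Matrix.neg_mul, Matrix.mul_neg, Matrix.mul_neg, neg_neg, hG]
  have hrank : (x - y).rank = (y - x).rank := rank_sub_comm x y
  obtain ⟨c, hc⟩ := constantOff_classSum hG hi
  refine ⟨c, ?_⟩
  simp only [toImage_eq_rangeRestrict]
  rw [← map_smul, ← map_smul, ← map_add, ← map_add]
  refine toImage_congr (by lia) (by lia) fun C hC => ?_
  rw [matFourier_add, matFourier_add, matFourier_smul, matFourier_smul, matFourier_single,
    matFourier_single, matFourier_charVec_yPartition hG (show 0 < (y - x).rank by lia) hd hde,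
    matFourier_charVec_yPartition hG' (show 0 < (x - y).rank by lia) (by rwa [hrank]) hde,
    ← neg_sub y x, classSum_neg _ _ hi]
  -- If χ_C(y - x) = 1 the transforms of x̂ and ŷ agree at `C`, so the correction vanishes there;
  -- otherwise the class sum equals c.
  by_cases hCM : matChar C (y - x) = 1
  · have hx : matChar C (-x) = matChar C (-y) := by
      have : -x = (y - x) + -y := by abel
      rw [this, AddChar.map_add_eq_mul, hCM, one_mul]
    rw [hx]
    push_cast
    ring
  · rw [hc C hC hCM]
    push_cast
    ring

/-- Classes other than 0 and 2 change by a multiple of E ŷ - E x̂. Class 0 follows from class 1 by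
the relation of `toImage_yPartition_zero` with x and y exchanged, and class 2 from the total sum θ_1
E ŷ. -/
theorem spaceS_swap_le (hM : 2 ≤ (y - x).rank) (hd : (y - x).rank < d) (hde : d < e) :
    spaceS y x ≤ spaceS x y := by
  have hM' : 2 ≤ (x - y).rank := by rwa [rank_sub_comm]
  have hd' : (x - y).rank < d := by rwa [rank_sub_comm]
  have hx := toImage_single_left_mem_spaceS hM hd hde
  have hy := toImage_single_right_mem_spaceS hM hd hde
  have hgen : ∀ i : Fin 6, i ≠ 0 ∧ i ≠ 2 →
      toImage (bilinearIdempotent F d e) (charVec (yPartition y x i)) ∈ spaceS x y := by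
    intro i hi
    obtain ⟨c, hc⟩ := exists_toImage_yPartition_swap hM hd hde hi
    rw [hc]
    exact Submodule.add_mem _ (Submodule.add_mem _ (toImage_charVec_mem_spaceS x y i)
      (Submodule.smul_mem _ _ hx)) (Submodule.smul_mem _ _ hy)
  have h0 : toImage (bilinearIdempotent F d e) (charVec (yPartition y x 0)) ∈ spaceS x y := by
    rw [toImage_yPartition_zero hM' hd' hde]
    exact Submodule.add_mem _ (Submodule.add_mem _ (hgen 1 (by decide))
      (Submodule.smul_mem _ _ hx)) (Submodule.smul_mem _ _ hy)
  have h2 : toImage (bilinearIdempotent F d e) (charVec (yPartition y x 2)) ∈ spaceS x y := by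
    obtain ⟨G, hG⟩ := exists_generalized_inverse (x - y)
    have h : toImage (bilinearIdempotent F d e) (∑ i, charVec (yPartition y x i)) =
        toImage (bilinearIdempotent F d e) (bilinearEigenvalue F d e 1 • Pi.single y 1) := by
      refine toImage_congr (by lia) (by lia) fun C hC => ?_
      rw [matFourier_sum, matFourier_smul, matFourier_single]
      simp only [matFourier_charVec_yPartition hG (show 0 < (x - y).rank by lia) hd' hde]
      rw [← Finset.mul_sum, sum_classSum_univ _ _ hC, mul_comm]
    rw [toImage_eq_rangeRestrict, toImage_eq_rangeRestrict, map_sum, map_smul,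
      ← Finset.add_sum_erase _ _ (Finset.mem_univ (2 : Fin 6)), ← eq_sub_iff_add_eq] at h
    rw [toImage_eq_rangeRestrict, h]
    refine Submodule.sub_mem _ (Submodule.smul_mem _ _ hy) (Submodule.sum_mem _ fun i hi => ?_)
    by_cases hi0 : i = 0
    · rw [hi0]
      exact h0
    · exact hgen i ⟨hi0, Finset.ne_of_mem_erase hi⟩
  rw [spaceS, Submodule.span_le]
  rintro _ ⟨i, rfl⟩
  by_cases hi0 : i = 0
  · rw [hi0]
    exact h0
  by_cases hi2 : i = 2
  · rw [hi2]
    exact h2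
  exact hgen i ⟨hi0, hi2⟩

theorem spaceS_swap (hM : 2 ≤ (y - x).rank) (hd : (y - x).rank < d) (hde : d < e) :
    spaceS y x = spaceS x y :=
  le_antisymm (spaceS_swap_le hM hd hde)
    (spaceS_swap_le (by rwa [rank_sub_comm]) (by rwa [rank_sub_comm]) hde)

end SpaceS

end

theorem lemma11p6 {F : Type*} [Field F] [Fintype F] [DecidableEq F] (hq : Fintype.card F ≠ 2)
    (D N : ℕ) (hD : 6 ≤ 2 * D) (hN : 2 * D < N)
    (x y : Matrix (Fin D) (Fin (N - D)) F)
    (hk : 2 ≤ (bilinearFormsGraph F D (N - D)).dist x y)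
    (hk' : (bilinearFormsGraph F D (N - D)).dist x y ≤ D - 1) :
    let E := bilinearIdempotent F D (N - D)
    (∀ s ∈ spaceS x y, nortonMul E (toImage E (Pi.single x 1)) s ∈ spaceS x y) ∧
    (∀ s ∈ spaceS x y, nortonMul E (toImage E (Pi.single y 1)) s ∈ spaceS x y) ∧
    ∃ C : Matrix (Fin 6) (Fin 6) ℕ,
      IsEquitablePartition (bilinearFormsGraph F D (N - D))
        (distSphere (bilinearFormsGraph F D (N - D)) 1 x) (yPartition x y) C ∧
      ∀ j : Fin 6,
        nortonMul E (toImage E (Pi.single x 1)) (toImage E (charVec (yPartition x y j))) =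
          (Fintype.card (Matrix (Fin D) (Fin (N - D)) F) : ℝ)⁻¹ •
            ∑ i : Fin 6, (C i j : ℝ) • toImage E (charVec (yPartition x y i)) := by
  intro E
  rw [bilinearFormsGraph_dist] at hk hk'
  have hM' : 2 ≤ (x - y).rank := hk
  have hd' : (x - y).rank < D := by lia
  have hM : 2 ≤ (y - x).rank := by rwa [rank_sub_comm]
  have hd : (y - x).rank < D := by rwa [rank_sub_comm]
  have hde : D < N - D := by lia
  refine ⟨nortonMul_single_mem_spaceS hq hM hd hde, ?_, ?_⟩
  -- Since S(x,y) = S(y,x), invariance under E ŷ is the first statement with x and y exchanged.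
  · rw [← spaceS_swap hM hd hde]
    exact nortonMul_single_mem_spaceS hq hM' hd' hde
  · obtain ⟨C, hC⟩ := exists_isEquitablePartition hq hM hd hde
    exact ⟨C, hC, nortonMul_single_charVec (by lia) (by lia) hC⟩
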